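/- For probability measures $P,Q$ on $\mathbb{R}^d$ with bounded support and $\eta>0$, let $$S(P,Q) := \inf_{\pi\in\Pi(P,Q)}\Big\{\int \|x-y\|^2\,d\pi(x,y) + \frac1\eta\,\mathsf{KL}(\pi\,\|\,P\otimes Q)\Big\},$$ where $\Pi(P,Q)$ is the set of couplings of $P$ and $Q$ (measures on $\mathbb{R}^d\times\mathbb{R}^d$ with marginals $P$ and $Q$), $\|\cdot\|$ is the Euclidean norm and $\mathsf{KL}$ is the Kullback--Leibler divergence. Theorem. For every $\eta>0$ there is a constant $C=C(\eta)>0$, depending only on $\eta$, such that the following holds for every dimension $d$, all Borel probability measures $\mu,\nu$ on $\mathbb{R}^d$ with $\|x\|\le 1/2$ for $\mu$-almost every $x$ and $\|y\|\le 1/2$ for $\nu$-almost every $y$, and every $n\ge 1$. Let $X_1,\dots,X_n\sim\mu$ be i.i.d. and $Y_1,\dots,Y_n\sim\nu$ be i.i.d., with the two samples independent of each other, let $\mu_n=\frac1n\sum_{i=1}^n\delta_{X_i}$ and $\nu_n=\frac1n\sum_{j=1}^n\delta_{Y_j}$ be the empirical measures, and put $S:=S(\mu,\nu)$, $S_n:=S(\mu_n,\nu_n)$.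 Then $S_n$ is integrable, $|S_n-S|^2$ is integrable, and $$\mathbb{E}|S_n-S|^2\le \frac{C}{n},\qquad |\mathbb{E}[S_n]-S|\le\frac{C}{n}.$$ Moreover, for all $t>0$, with probability at least $1-6e^{-t}$, $$|S_n-S|\le C\Big(\frac tn+\sqrt{\frac tn}\Big).$$ -/

import Mathlib

open MeasureTheory ProbabilityTheory InformationTheory
open scoped ENNReal

noncomputable section

/-- The set `Π(P, Q)` of couplings of `P` and `Q`: measures on the product space whose first
marginal is `P` and whose second marginal is `Q`. -/
def couplings {E : Type*} [MeasurableSpace E] (P Q : Measure E) : Set (Measure (E × E)) :=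
  {π | π.map Prod.fst = P ∧ π.map Prod.snd = Q}

/-- The entropic optimal transport objective
`π(‖x - y‖²) + η⁻¹ KL(π ‖ P ⊗ Q)`, with values in `[0, ∞]`. -/
def entropicObjective {E : Type*} [NormedAddCommGroup E] [MeasurableSpace E]
    (η : ℝ) (P Q : Measure E) (π : Measure (E × E)) : ℝ≥0∞ :=
  (∫⁻ z, ENNReal.ofReal (‖z.1 - z.2‖ ^ 2) ∂π) + ENNReal.ofReal (1 / η) * klDiv π (P.prod Q)

/-- The entropic optimal transport cost as an infimum in `[0, ∞]`. -/
def entropicCostENN {E : Type*} [NormedAddCommGroup E] [MeasurableSpace E]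
    (η : ℝ) (P Q : Measure E) : ℝ≥0∞ :=
  ⨅ π ∈ couplings P Q, entropicObjective η P Q π

/-- For probability measures supported in the ball of radius `1 / 2` the infimum is at most `1`
(use the product coupling), so no information is lost in passing to the real number below. -/
theorem entropicCostENN_le_one {E : Type*} [NormedAddCommGroup E] [MeasurableSpace E]
    (η : ℝ) (P Q : Measure E) [IsProbabilityMeasure P] [IsProbabilityMeasure Q]
    (hP : ∀ᵐ x ∂P, ‖x‖ ≤ 1 / 2) (hQ : ∀ᵐ y ∂Q, ‖y‖ ≤ 1 / 2) :
    entropicCostENN η P Q ≤ 1 := by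
  have hmem : P.prod Q ∈ couplings P Q := by
    constructor
    · simp [Measure.map_fst_prod]
    · simp [Measure.map_snd_prod]
  refine (iInf₂_le (P.prod Q) hmem).trans ?_
  have h1 : ∀ᵐ z ∂(P.prod Q), ‖z.1‖ ≤ 1 / 2 :=
    Measure.quasiMeasurePreserving_fst.ae hP
  have h2 : ∀ᵐ z ∂(P.prod Q), ‖z.2‖ ≤ 1 / 2 :=
    Measure.quasiMeasurePreserving_snd.ae hQ
  have h3 : (∫⁻ z, ENNReal.ofReal (‖z.1 - z.2‖ ^ 2) ∂(P.prod Q)) ≤ ∫⁻ _, 1 ∂(P.prod Q) := by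
    refine lintegral_mono_ae ?_
    filter_upwards [h1, h2] with z hz1 hz2
    rw [← ENNReal.ofReal_one]
    refine ENNReal.ofReal_le_ofReal ?_
    have := norm_sub_le z.1 z.2
    nlinarith [norm_nonneg (z.1 - z.2)]
  simpa [entropicObjective] using h3

/-- The entropic optimal transport cost `S(P, Q)` as a real number. -/
def entropicCost {E : Type*} [NormedAddCommGroup E] [MeasurableSpace E]
    (η : ℝ) (P Q : Measure E) : ℝ :=
  (entropicCostENN η P Q).toReal

/-- The empirical measure `n⁻¹ ∑ i, δ_{x i}` of the points `x 0, …, x (n - 1)`. -/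
def empiricalMeasure {E : Type*} [MeasurableSpace E] {n : ℕ} (x : Fin n → E) : Measure E :=
  (n : ℝ≥0∞)⁻¹ • ∑ i, Measure.dirac (x i)

/-- The plug-in estimator `S_n = S(μ_n, ν_n)` computed from the data points `x`, `y`. -/
def plugInCost {E : Type*} [NormedAddCommGroup E] [MeasurableSpace E] {n : ℕ}
    (η : ℝ) (x y : Fin n → E) : ℝ :=
  entropicCost η (empiricalMeasure x) (empiricalMeasure y)

end

/-!
The proof rests on the dual problem. With `k = η min (‖x - y‖², 1)`, which equals `η ‖x - y‖²` on
the ball of radius `1 / 2`, `η S(P, Q)` is the maximum over bounded continuous potentials of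
`∫ φ dP + ∫ ψ dQ - (∫∫ exp (φ + ψ - k) dP dQ - 1)` (`entropicCost_eq_dualValue_div`). Maximizers are
the Schrödinger potentials, for which `exp (φ + ψ - k)` has both marginals equal to one. They exist
because the alternating marginal fitting contracts oscillations (`exists_isSchrodinger`), and the
marginal equations alone give them oscillation at most `η` and the density values in
`[exp (-2η), exp (2η)]`, whatever the measures and the dimension.

*Bias.* The population potentials are admissible in the empirical problem, where their objective is
an unbiased estimator of the population value; hence the bias is nonnegative. Conversely, on
potentials with bounded densities the dual objective is strongly concave in `L²`, so the loss from
using the population potentials is at most a constant times the squared `L²` norm of the gradient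
(`dualValue_le_add_marginal_error`). The gradient consists of empirical means of centred bounded
functions, and its expected squared norm is `O(1 / n)`.

*Fluctuations.* Replacing one sample point changes the empirical value by at most `η / n`, because
Schrödinger potentials, defined on the whole space, satisfy one of the marginal equations for the
modified sample as well (`dualValue_empiricalMeasure_sub_le`). McDiarmid's inequality
(`hasSubgaussianMGF_of_bounded_differences`) then gives sub-Gaussian fluctuations with variance
proxy `O(1 / n)`, hence the mean squared error and the tail bound. In the tail bound the bias is
absorbed by `t / n` when `t ≥ 1`, and for `t < 1` the claimed probability is negative.
-/

/-! ### Truncated cost and Gibbs densities -/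

section Potentials

open Real BoundedContinuousFunction

variable {E : Type*} [NormedAddCommGroup E]

/-- The quadratic cost in units of the regularization strength, truncated at distance `1` so that
it is bounded and continuous on the whole space. It agrees with `η ‖x - y‖²` on the ball of
radius `1 / 2`. -/
def scaledCost (η : ℝ) (x y : E) : ℝ := η * min (‖x - y‖ ^ 2) 1

lemma scaledCost_nonneg {η : ℝ} (hη : 0 ≤ η) (x y : E) : 0 ≤ scaledCost η x y :=
  mul_nonneg hη (le_min (by positivity) zero_le_one)

lemma scaledCost_le {η : ℝ} (hη : 0 ≤ η) (x y : E) : scaledCost η x y ≤ η :=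
  mul_le_of_le_one_right hη (min_le_right _ _)

lemma scaledCost_comm (η : ℝ) (x y : E) : scaledCost η x y = scaledCost η y x := by
  simp [scaledCost, norm_sub_rev]

@[fun_prop]
lemma Continuous.scaledCost {X : Type*} [TopologicalSpace X] {f g : X → E} (η : ℝ)
    (hf : Continuous f) (hg : Continuous g) : Continuous fun z => scaledCost η (f z) (g z) := by
  unfold _root_.scaledCost
  fun_prop

lemma scaledCost_of_norm_le {η : ℝ} {x y : E} (hx : ‖x‖ ≤ 1 / 2) (hy : ‖y‖ ≤ 1 / 2) :
    scaledCost η x y = η * ‖x - y‖ ^ 2 := by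
  have h := norm_sub_le x y
  rw [scaledCost, min_eq_left]
  nlinarith [norm_nonneg (x - y)]

/-- The density `exp (φ(x) + ψ(y) - k(x, y))`, with `k` the scaled cost, of the Gibbs measure with
potentials `φ` and `ψ` relative to a product measure. -/
noncomputable def gibbsDensity (η : ℝ) (φ ψ : E →ᵇ ℝ) (x y : E) : ℝ :=
  exp (φ x + ψ y - scaledCost η x y)

lemma gibbsDensity_pos (η : ℝ) (φ ψ : E →ᵇ ℝ) (x y : E) : 0 < gibbsDensity η φ ψ x y := exp_pos _

lemma gibbsDensity_swap (η : ℝ) (φ ψ : E →ᵇ ℝ) (x y : E) :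
    gibbsDensity η φ ψ x y = gibbsDensity η ψ φ y x := by
  rw [gibbsDensity, gibbsDensity, scaledCost_comm, add_comm (φ x)]

@[fun_prop]
lemma Continuous.gibbsDensity {X : Type*} [TopologicalSpace X] {f g : X → E} (η : ℝ)
    (φ ψ : E →ᵇ ℝ) (hf : Continuous f) (hg : Continuous g) :
    Continuous fun z => gibbsDensity η φ ψ (f z) (g z) := by
  unfold _root_.gibbsDensity
  fun_prop

lemma gibbsDensity_le_exp_norm {η : ℝ} (hη : 0 ≤ η) (φ ψ : E →ᵇ ℝ) (x y : E) :
    gibbsDensity η φ ψ x y ≤ exp (‖φ‖ + ‖ψ‖) := by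
  refine exp_le_exp.2 ?_
  linarith [scaledCost_nonneg hη x y, (abs_le.1 (φ.norm_coe_le_norm x)).2,
    (abs_le.1 (ψ.norm_coe_le_norm y)).2]

lemma integrable_of_continuous_of_abs_le {X : Type*} [TopologicalSpace X] [MeasurableSpace X]
    [OpensMeasurableSpace X] {R : Measure X} [IsFiniteMeasure R] {f : X → ℝ}
    (hf : Continuous f) (C : ℝ) (hC : ∀ x, |f x| ≤ C) : Integrable f R :=
  Integrable.of_bound hf.measurable.aestronglyMeasurable C (Filter.Eventually.of_forall hC)

lemma integrable_gibbsDensity {η : ℝ} (hη : 0 ≤ η) (φ ψ : E →ᵇ ℝ) {X : Type*}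
    [TopologicalSpace X] [MeasurableSpace X] [OpensMeasurableSpace X] {R : Measure X}
    [IsFiniteMeasure R] {f g : X → E} (hf : Continuous f) (hg : Continuous g) :
    Integrable (fun z => gibbsDensity η φ ψ (f z) (g z)) R := by
  refine integrable_of_continuous_of_abs_le (by fun_prop) (exp (‖φ‖ + ‖ψ‖)) fun z => ?_
  rw [abs_of_pos (gibbsDensity_pos _ _ _ _ _)]
  exact gibbsDensity_le_exp_norm hη _ _ _ _

variable [MeasurableSpace E] [BorelSpace E]

/-! ### The log-Laplace transform and its contraction property -/

/-- The partition function `∫ exp (ψ(y) - k(x, y)) dQ(y)`. -/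
noncomputable def partitionFun (η : ℝ) (Q : Measure E) (ψ : E →ᵇ ℝ) (x : E) : ℝ :=
  ∫ y, exp (ψ y - scaledCost η x y) ∂Q

variable {η : ℝ} {P Q : Measure E} [IsProbabilityMeasure P] [IsProbabilityMeasure Q]

lemma integrable_exp_sub_scaledCost (hη : 0 ≤ η) (ψ : E →ᵇ ℝ) (x : E) :
    Integrable (fun y => exp (ψ y - scaledCost η x y)) Q := by
  refine integrable_of_continuous_of_abs_le (by fun_prop) (exp ‖ψ‖) fun y => ?_
  rw [abs_exp]
  refine exp_le_exp.2 ?_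
  linarith [scaledCost_nonneg hη x y, (abs_le.1 (ψ.norm_coe_le_norm y)).2]

lemma exp_le_partitionFun (hη : 0 ≤ η) {ψ : E →ᵇ ℝ} {m : ℝ} (hm : ∀ y, m ≤ ψ y) (x : E) :
    exp (m - η) ≤ partitionFun η Q ψ x := by
  have : ∫ _, exp (m - η) ∂Q ≤ partitionFun η Q ψ x := by
    refine integral_mono (integrable_const _) (integrable_exp_sub_scaledCost hη ψ x) fun y => ?_
    exact exp_le_exp.2 (by linarith [scaledCost_le hη x y, hm y])
  simpa using this

lemma partitionFun_le_exp (hη : 0 ≤ η) {ψ : E →ᵇ ℝ} {m : ℝ} (hm : ∀ y, ψ y ≤ m) (x : E) :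
    partitionFun η Q ψ x ≤ exp m := by
  have : partitionFun η Q ψ x ≤ ∫ _, exp m ∂Q := by
    refine integral_mono (integrable_exp_sub_scaledCost hη ψ x) (integrable_const _) fun y => ?_
    exact exp_le_exp.2 (by linarith [scaledCost_nonneg hη x y, hm y])
  simpa using this

lemma partitionFun_pos (hη : 0 ≤ η) (ψ : E →ᵇ ℝ) (x : E) : 0 < partitionFun η Q ψ x :=
  (exp_pos _).trans_le
    (exp_le_partitionFun hη (fun y => (abs_le.1 (ψ.norm_coe_le_norm y)).1) x)

lemma partitionFun_le_exp_mul (hη : 0 ≤ η) {ψ ψ' : E →ᵇ ℝ} {D : ℝ} (h : ∀ y, ψ y ≤ ψ' y + D)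
    (x : E) : partitionFun η Q ψ x ≤ exp D * partitionFun η Q ψ' x := by
  rw [partitionFun, partitionFun, ← integral_const_mul]
  refine integral_mono (integrable_exp_sub_scaledCost hη ψ x)
    ((integrable_exp_sub_scaledCost hη ψ' x).const_mul _) fun y => ?_
  simp only
  rw [← exp_add]
  exact exp_le_exp.2 (by linarith [h y])

lemma continuous_partitionFun (hη : 0 ≤ η) (ψ : E →ᵇ ℝ) : Continuous (partitionFun η Q ψ) := by
  refine continuous_of_dominated (bound := fun _ => exp ‖ψ‖)
    (fun x => (integrable_exp_sub_scaledCost hη ψ x).aestronglyMeasurable)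
    (fun x => Filter.Eventually.of_forall fun y => ?_) (integrable_const _)
    (Filter.Eventually.of_forall fun y => by fun_prop)
  rw [Real.norm_eq_abs, abs_exp]
  refine exp_le_exp.2 ?_
  linarith [scaledCost_nonneg hη x y, (abs_le.1 (ψ.norm_coe_le_norm y)).2]

/-- The smoothed `k`-transform `x ↦ -log ∫ exp (ψ(y) - k(x, y)) dQ(y)` of a potential: the unique
`φ` for which the Gibbs density `exp (φ(x) + ψ(y) - k(x, y))` integrates to one in `y`. -/
noncomputable def softTransform (hη : 0 ≤ η) (Q : Measure E) [IsProbabilityMeasure Q]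
    (ψ : E →ᵇ ℝ) : E →ᵇ ℝ :=
  BoundedContinuousFunction.ofNormedAddCommGroup (fun x => -log (partitionFun η Q ψ x))
    ((continuous_partitionFun hη ψ).log fun x => (partitionFun_pos hη ψ x).ne').neg
    (‖ψ‖ + η) fun x => by
      have h1 := log_le_log (exp_pos _)
        (exp_le_partitionFun (Q := Q) hη (fun y => (abs_le.1 (ψ.norm_coe_le_norm y)).1) x)
      have h2 := log_le_log (partitionFun_pos hη ψ x)
        (partitionFun_le_exp (Q := Q) hη (fun y => (abs_le.1 (ψ.norm_coe_le_norm y)).2) x)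
      rw [log_exp] at h1 h2
      rw [norm_neg, Real.norm_eq_abs, abs_le]
      constructor <;> linarith

lemma softTransform_apply (hη : 0 ≤ η) (ψ : E →ᵇ ℝ) (x : E) :
    softTransform hη Q ψ x = -log (partitionFun η Q ψ x) := rfl

lemma exp_neg_softTransform (hη : 0 ≤ η) (ψ : E →ᵇ ℝ) (x : E) :
    exp (-softTransform hη Q ψ x) = partitionFun η Q ψ x := by
  rw [softTransform_apply, neg_neg, exp_log (partitionFun_pos hη ψ x)]

lemma softTransform_le_add (hη : 0 ≤ η) {ψ ψ' : E →ᵇ ℝ} {D : ℝ} (h : ∀ y, ψ y ≤ ψ' y + D)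
    (x : E) : softTransform hη Q ψ' x ≤ softTransform hη Q ψ x + D := by
  have h1 := log_le_log (partitionFun_pos hη ψ x) (partitionFun_le_exp_mul (Q := Q) hη h x)
  rw [log_mul (exp_pos _).ne' (partitionFun_pos hη ψ' x).ne', log_exp] at h1
  rw [softTransform_apply, softTransform_apply]
  linarith

lemma continuous_softTransform (hη : 0 ≤ η) :
    Continuous (softTransform hη Q : (E →ᵇ ℝ) → E →ᵇ ℝ) := by
  refine (LipschitzWith.of_dist_le_mul (K := 1) fun ψ ψ' => ?_).continuous
  rw [NNReal.coe_one, one_mul, BoundedContinuousFunction.dist_le dist_nonneg]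
  intro x
  have h (y : E) := abs_le.1
    ((Real.dist_eq _ _).symm.trans_le (dist_coe_le_dist (f := ψ) (g := ψ') y))
  have h1 := softTransform_le_add (Q := Q) hη (D := dist ψ ψ') (ψ := ψ) (ψ' := ψ')
    (fun y => by linarith [(h y).2]) x
  have h2 := softTransform_le_add (Q := Q) hη (D := dist ψ ψ') (ψ := ψ') (ψ' := ψ)
    (fun y => by linarith [(h y).1]) x
  rw [Real.dist_eq, abs_le]
  constructor <;> linarith

lemma softTransform_sub_le (hη : 0 ≤ η) (ψ : E →ᵇ ℝ) (x x' : E) :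
    softTransform hη Q ψ x - softTransform hη Q ψ x' ≤ η := by
  have h : partitionFun η Q ψ x' ≤ exp η * partitionFun η Q ψ x := by
    rw [partitionFun, partitionFun, ← integral_const_mul]
    refine integral_mono (integrable_exp_sub_scaledCost hη ψ x')
      ((integrable_exp_sub_scaledCost hη ψ x).const_mul _) fun y => ?_
    simp only
    rw [← exp_add]
    exact exp_le_exp.2 (by linarith [scaledCost_nonneg hη x' y, scaledCost_le hη x y])
  have h1 := log_le_log (partitionFun_pos hη ψ x') h
  rw [log_mul (exp_pos _).ne' (partitionFun_pos hη ψ x).ne', log_exp] at h1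
  rw [softTransform_apply, softTransform_apply]
  linarith

/-- Comparing two values of `∫ w(y) exp (-k(x, y)) dQ(y)` for `w = exp (ψ' + M) - exp ψ ≥ 0`: moving
the base point costs at most a factor `exp η`. -/
lemma exp_neg_mul_partitionFun_sub_le (hη : 0 ≤ η) {ψ ψ' : E →ᵇ ℝ} {M : ℝ}
    (h : ∀ y, ψ y ≤ ψ' y + M) (x x' : E) :
    exp (-η) * (exp M * partitionFun η Q ψ' x' - partitionFun η Q ψ x')
      ≤ exp M * partitionFun η Q ψ' x - partitionFun η Q ψ x := by
  have key (z : E) : exp M * partitionFun η Q ψ' z - partitionFun η Q ψ z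
      = ∫ y, (exp (ψ' y + M) - exp (ψ y)) * exp (-scaledCost η z y) ∂Q := by
    rw [partitionFun, partitionFun, ← integral_const_mul, ← integral_sub
      ((integrable_exp_sub_scaledCost hη ψ' z).const_mul _) (integrable_exp_sub_scaledCost hη ψ z)]
    refine integral_congr_ae (Filter.Eventually.of_forall fun y => ?_)
    simp only [sub_mul, exp_sub, exp_add, exp_neg]
    ring
  have hint (z : E) : Integrable
      (fun y => (exp (ψ' y + M) - exp (ψ y)) * exp (-scaledCost η z y)) Q := by
    refine (((integrable_exp_sub_scaledCost hη ψ' z).const_mul (exp M)).sub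
      (integrable_exp_sub_scaledCost hη ψ z)).congr (Filter.Eventually.of_forall fun y => ?_)
    simp only [Pi.sub_apply, sub_mul, exp_sub, exp_add, exp_neg]
    ring
  rw [key, key, ← integral_const_mul]
  refine integral_mono ((hint x').const_mul _) (hint x) fun y => ?_
  have h0 : 0 ≤ exp (ψ' y + M) - exp (ψ y) := sub_nonneg.2 (exp_le_exp.2 (h y))
  have h1 : exp (-η) * exp (-scaledCost η x' y) ≤ exp (-scaledCost η x y) := by
    rw [← exp_add]
    exact exp_le_exp.2 (by linarith [scaledCost_nonneg hη x' y, scaledCost_le hη x y])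
  calc exp (-η) * ((exp (ψ' y + M) - exp (ψ y)) * exp (-scaledCost η x' y))
      = (exp (ψ' y + M) - exp (ψ y)) * (exp (-η) * exp (-scaledCost η x' y)) := by ring
    _ ≤ _ := mul_le_mul_of_nonneg_left h1 h0

/-- The transform strictly contracts oscillations, as long as they stay bounded. This is a
quantitative form of Doeblin's condition: the measures with densities proportional to
`exp (ψ' - k(x, ·))` for different `x` share a common part of mass at least `exp (-2η)`. -/
lemma softTransform_oscillation_le (hη : 0 ≤ η) {ψ ψ' : E →ᵇ ℝ} {D D₀ : ℝ} (hD₀ : D ≤ D₀)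
    (h : ∀ y y', (ψ y - ψ' y) - (ψ y' - ψ' y') ≤ D) (x x' : E) :
    (softTransform hη Q ψ x - softTransform hη Q ψ' x)
      - (softTransform hη Q ψ x' - softTransform hη Q ψ' x')
      ≤ (1 - exp (-(2 * η)) / (1 + D₀)) * D := by
  have hD : 0 ≤ D := by simpa using h 0 0
  obtain ⟨m, hm1, hm2⟩ : ∃ m, (∀ y, m ≤ ψ y - ψ' y) ∧ ∀ y, ψ y ≤ ψ' y + (m + D) := by
    have hb : BddBelow (Set.range fun y => ψ y - ψ' y) :=
      ⟨ψ 0 - ψ' 0 - D, by rintro _ ⟨y, rfl⟩; linarith [h 0 y]⟩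
    refine ⟨⨅ y, (ψ y - ψ' y), fun y => ciInf_le hb y, fun y => ?_⟩
    have : ψ y - ψ' y - D ≤ ⨅ y, (ψ y - ψ' y) := le_ciInf fun y' => by linarith [h y y']
    linarith
  set N := partitionFun η Q ψ
  set Z := partitionFun η Q ψ'
  have hN (z) : 0 < N z := partitionFun_pos hη ψ z
  have hZ (z) : 0 < Z z := partitionFun_pos hη ψ' z
  set κ := exp (-η) with hκ
  have hκ0 : 0 < κ := exp_pos _
  have hκ2 : exp (-(2 * η)) = κ ^ 2 := by rw [hκ, ← exp_nat_mul]; ring_nf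
  -- The roles of the two base points are exchanged because the transform carries a minus sign.
  have h1 : κ * (exp (m + D) * Z x - N x) ≤ exp (m + D) * Z x' - N x' :=
    exp_neg_mul_partitionFun_sub_le hη hm2 x' x
  have h2 : κ * Z x' ≤ Z x := by
    have := softTransform_sub_le (Q := Q) hη ψ' x x'
    simp only [hκ, Z]
    rw [← exp_neg_softTransform hη ψ' x, ← exp_neg_softTransform hη ψ' x', ← exp_add]
    exact exp_le_exp.2 (by linarith)
  have h3 : exp m * Z x ≤ N x := by
    have := partitionFun_le_exp_mul (Q := Q) hη (ψ := ψ') (ψ' := ψ) (D := -m)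
      (fun y => by linarith [hm1 y]) x
    calc exp m * Z x ≤ exp m * (exp (-m) * N x) := by gcongr
      _ = N x := by rw [← mul_assoc, ← exp_add]; simp
  have h4 : 0 ≤ exp (m + D) * Z x - N x :=
    sub_nonneg.2 (partitionFun_le_exp_mul hη hm2 x)
  set A := N x' / Z x' with hA
  set B := N x / Z x with hB
  have hB0 : 0 < B := div_pos (hN x) (hZ x)
  have hA0 : 0 < A := div_pos (hN x') (hZ x')
  have hBm : exp m ≤ B := by rw [hB, le_div_iff₀ (hZ x)]; exact h3
  have hAB : κ ^ 2 * (exp (m + D) - B) ≤ exp (m + D) - A := by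
    have e1 : exp (m + D) * Z x' - N x' = (exp (m + D) - A) * Z x' := by
      rw [hA, sub_mul, div_mul_cancel₀ _ (hZ x').ne']
    have e2 : exp (m + D) * Z x - N x = (exp (m + D) - B) * Z x := by
      rw [hB, sub_mul, div_mul_cancel₀ _ (hZ x).ne']
    rw [e1, e2] at h1
    have h5 : 0 ≤ exp (m + D) - B := by
      rw [e2] at h4
      exact nonneg_of_mul_nonneg_left h4 (hZ x)
    refine le_of_mul_le_mul_right ?_ (hZ x')
    calc κ ^ 2 * (exp (m + D) - B) * Z x' = κ * ((exp (m + D) - B) * (κ * Z x')) := by ring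
      _ ≤ κ * ((exp (m + D) - B) * Z x) := by gcongr
      _ ≤ _ := h1
  have hκ1 : κ ^ 2 ≤ 1 := by
    rw [← hκ2]; exact exp_le_one_iff.2 (by linarith)
  have hratio : A ≤ B * (exp D * (1 - κ ^ 2 * (1 - exp (-D)))) := by
    have : (1 - κ ^ 2) * exp (m + D) ≤ (1 - κ ^ 2) * (B * exp D) := by
      rw [exp_add]
      gcongr
    have e : exp D * exp (-D) = 1 := by rw [← exp_add]; simp
    calc A ≤ (1 - κ ^ 2) * (B * exp D) + κ ^ 2 * B := by linarith
      _ = B * (exp D - κ ^ 2 * exp D + κ ^ 2 * (exp D * exp (-D))) := by rw [e]; ring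
      _ = _ := by ring
  have hexp : D / (1 + D₀) ≤ 1 - exp (-D) := by
    have : exp (-D) ≤ 1 / (1 + D) := by
      rw [exp_neg, ← one_div]
      exact one_div_le_one_div_of_le (by linarith) (by linarith [add_one_le_exp D])
    calc D / (1 + D₀) ≤ D / (1 + D) := by gcongr
      _ = 1 - 1 / (1 + D) := by field_simp; ring
      _ ≤ _ := by linarith
  have hfac : 1 - κ ^ 2 * (1 - exp (-D)) ≤ exp (-(κ ^ 2 * (D / (1 + D₀)))) := by
    have := add_one_le_exp (-(κ ^ 2 * (D / (1 + D₀))))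
    have : κ ^ 2 * (D / (1 + D₀)) ≤ κ ^ 2 * (1 - exp (-D)) := by gcongr
    linarith
  have hfin : A ≤ B * exp (D - κ ^ 2 * (D / (1 + D₀))) := by
    refine hratio.trans ?_
    rw [sub_eq_add_neg D, exp_add]
    gcongr
  have hlog := log_le_log hA0 hfin
  rw [log_mul hB0.ne' (exp_pos _).ne', log_exp, hA, hB, log_div (hN _).ne' (hZ _).ne',
    log_div (hN _).ne' (hZ _).ne'] at hlog
  simp only [softTransform_apply]
  rw [hκ2]
  have : (1 - κ ^ 2 / (1 + D₀)) * D = D - κ ^ 2 * (D / (1 + D₀)) := by ring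
  rw [this]
  linarith

/-! ### Schrödinger potentials -/

/-- `φ` and `ψ` are Schrödinger potentials for `(P, Q)`: the Gibbs density integrates to one in
each variable, at every value of the other variable (not only almost everywhere). -/
structure IsSchrodinger (η : ℝ) (P Q : Measure E) (φ ψ : E →ᵇ ℝ) : Prop where
  integral_right : ∀ x, ∫ y, gibbsDensity η φ ψ x y ∂Q = 1
  integral_left : ∀ y, ∫ x, gibbsDensity η φ ψ x y ∂P = 1

omit [BorelSpace E] [IsProbabilityMeasure P] [IsProbabilityMeasure Q] in
lemma IsSchrodinger.symm {φ ψ : E →ᵇ ℝ} (h : IsSchrodinger η P Q φ ψ) :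
    IsSchrodinger η Q P ψ φ :=
  ⟨fun x => by simpa only [gibbsDensity_swap η ψ φ] using h.integral_left x,
    fun y => by simpa only [gibbsDensity_swap η ψ φ] using h.integral_right y⟩

lemma integral_gibbsDensity_softTransform (hη : 0 ≤ η) (ψ : E →ᵇ ℝ) (x : E) :
    ∫ y, gibbsDensity η (softTransform hη Q ψ) ψ x y ∂Q = 1 := by
  have : ∀ y, gibbsDensity η (softTransform hη Q ψ) ψ x y
      = exp (softTransform hη Q ψ x) * exp (ψ y - scaledCost η x y) := fun y => by
    rw [gibbsDensity, ← exp_add]; ring_nf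
  simp_rw [this]
  rw [integral_const_mul]
  change _ * partitionFun η Q ψ x = 1
  rw [← exp_neg_softTransform hη, ← exp_add]
  simp

variable (P Q) in
/-- Schrödinger potentials exist: the iteration `ψ ↦ T_P (T_Q ψ)`, normalized to vanish at the
origin, converges geometrically in the supremum norm because each step contracts oscillations. At
the limit the normalizing constant is zero, since both marginal conditions fix the total mass of
the Gibbs measure. -/
theorem exists_isSchrodinger [SecondCountableTopology E] (hη : 0 ≤ η) :
    ∃ φ ψ : E →ᵇ ℝ, IsSchrodinger η P Q φ ψ := by
  set T : (E →ᵇ ℝ) → E →ᵇ ℝ := fun ψ => softTransform hη P (softTransform hη Q ψ) -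
    BoundedContinuousFunction.const E (softTransform hη P (softTransform hη Q ψ) 0) with hT
  have hTc : Continuous T := by
    have h1 : Continuous fun ψ => softTransform hη P (softTransform hη Q ψ) :=
      (continuous_softTransform hη).comp (continuous_softTransform hη)
    have h2 : LipschitzWith 1 (BoundedContinuousFunction.const E : ℝ → E →ᵇ ℝ) :=
      LipschitzWith.of_dist_le_mul fun a b => by
        rw [NNReal.coe_one, one_mul, BoundedContinuousFunction.dist_le dist_nonneg]
        exact fun _ => le_rfl
    exact h1.sub (h2.continuous.comp
      ((BoundedContinuousFunction.lipschitz_eval_const (0 : E)).continuous.comp h1))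
  have hTa (ψ : E →ᵇ ℝ) (y : E) : T ψ y = softTransform hη P (softTransform hη Q ψ) y -
      softTransform hη P (softTransform hη Q ψ) 0 := rfl
  set r := 1 - exp (-(2 * η)) / (1 + η) with hr
  have hr0 : 0 ≤ r := by
    have : exp (-(2 * η)) / (1 + η) ≤ 1 :=
      div_le_one_of_le₀ ((exp_le_one_iff.2 (by linarith)).trans (by linarith)) (by linarith)
    linarith
  have hr1 : r < 1 := by
    have : 0 < exp (-(2 * η)) / (1 + η) := by positivity
    linarith
  have hosc (n : ℕ) : ∀ y y', (T^[n + 1] 0 y - T^[n] 0 y) - (T^[n + 1] 0 y' - T^[n] 0 y')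
      ≤ r ^ n * η := by
    induction n with
    | zero =>
      intro y y'
      simp only [zero_add, Function.iterate_one, Function.iterate_zero, id, pow_zero, one_mul, hTa,
        BoundedContinuousFunction.coe_zero, Pi.zero_apply]
      linarith [softTransform_sub_le (Q := P) hη (softTransform hη Q 0) y y']
    | succ n ih =>
      intro y y'
      have hle : r ^ n * η ≤ η := mul_le_of_le_one_left hη (pow_le_one₀ hr0 hr1.le)
      have hle' : r * (r ^ n * η) ≤ r ^ n * η :=
        mul_le_of_le_one_left (by positivity) hr1.le
      have h1 := softTransform_oscillation_le (Q := Q) hη hle ih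
      have h2 := softTransform_oscillation_le (Q := P) hη (hle'.trans hle) h1 y y'
      have h3 : r * (r * (r ^ n * η)) ≤ r * (r ^ n * η) := by gcongr
      rw [Function.iterate_succ_apply', Function.iterate_succ_apply' T n, hTa, hTa, hTa, hTa,
        ← Function.iterate_succ_apply' T n, pow_succ']
      linarith
  have hzero (n : ℕ) : T^[n] 0 0 = 0 := by
    cases n with
    | zero => rfl
    | succ n => rw [Function.iterate_succ_apply', hTa, sub_self]
  have hdist (n : ℕ) : dist (T^[n] 0) (T^[n + 1] 0) ≤ η * r ^ n := by
    rw [BoundedContinuousFunction.dist_le (by positivity)]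
    intro y
    have h1 := hosc n y 0
    have h2 := hosc n 0 y
    rw [hzero, hzero] at h1 h2
    rw [Real.dist_eq, abs_le]
    constructor <;> linarith
  obtain ⟨ψ, hψ⟩ := cauchySeq_tendsto_of_complete (cauchySeq_of_le_geometric r η hr1 hdist)
  have hfix : T ψ = ψ := isFixedPt_of_tendsto_iterate hψ hTc.continuousAt
  set φ := softTransform hη Q ψ with hφ
  set a := softTransform hη P φ 0
  have hright (x : E) : ∫ y, gibbsDensity η φ ψ x y ∂Q = 1 :=
    integral_gibbsDensity_softTransform hη ψ x
  have hleft (y : E) : ∫ x, gibbsDensity η φ ψ x y ∂P = exp (-a) := by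
    have h1 := integral_gibbsDensity_softTransform (Q := P) hη φ y
    have h2 : softTransform hη P φ y = ψ y + a := by
      have := congrArg (fun f : E →ᵇ ℝ => f y) hfix
      simp only [hTa] at this
      linarith
    have h3 (x : E) : gibbsDensity η (softTransform hη P φ) φ y x
        = exp a * gibbsDensity η φ ψ x y := by
      rw [gibbsDensity, gibbsDensity, h2, scaledCost_comm, ← exp_add]; ring_nf
    simp_rw [h3] at h1
    rw [integral_const_mul] at h1
    rw [exp_neg]
    exact eq_inv_of_mul_eq_one_right h1
  have hswap : ∫ x, ∫ y, gibbsDensity η φ ψ x y ∂Q ∂P = ∫ y, ∫ x, gibbsDensity η φ ψ x y ∂P ∂Q :=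
    integral_integral_swap (integrable_gibbsDensity hη φ ψ continuous_fst continuous_snd)
  simp only [hright, hleft, integral_const, probReal_univ, smul_eq_mul, one_mul] at hswap
  exact ⟨φ, ψ, hright, fun y => by rw [hleft, ← hswap]⟩

omit [IsProbabilityMeasure P] in
lemma IsSchrodinger.sub_le (hη : 0 ≤ η) {φ ψ : E →ᵇ ℝ} (h : IsSchrodinger η P Q φ ψ) (x x' : E) :
    φ x - φ x' ≤ η := by
  have hle : ∫ y, gibbsDensity η φ ψ x y ∂Q
      ≤ 1 := (h.integral_right x).le
  have hge : ∫ y, exp (φ x - φ x' - η) * gibbsDensity η φ ψ x' y ∂Q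
      ≤ ∫ y, gibbsDensity η φ ψ x y ∂Q := by
    refine integral_mono
      ((integrable_gibbsDensity hη φ ψ continuous_const continuous_id).const_mul _)
      (integrable_gibbsDensity hη φ ψ continuous_const continuous_id) fun y => ?_
    simp only [gibbsDensity]
    rw [← exp_add]
    exact exp_le_exp.2 (by linarith [scaledCost_nonneg hη x' y, scaledCost_le hη x y])
  rw [integral_const_mul, h.integral_right, mul_one] at hge
  linarith [exp_le_one_iff.1 (hge.trans hle)]

lemma IsSchrodinger.gibbsDensity_le (hη : 0 ≤ η) {φ ψ : E →ᵇ ℝ} (h : IsSchrodinger η P Q φ ψ)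
    (x y : E) : gibbsDensity η φ ψ x y ≤ exp (2 * η) := by
  have : ∫ _, exp (-(2 * η)) * gibbsDensity η φ ψ x y ∂Q ≤ ∫ y', gibbsDensity η φ ψ x y' ∂Q := by
    refine integral_mono (integrable_const _)
      (integrable_gibbsDensity hη φ ψ continuous_const continuous_id) fun y' => ?_
    simp only [gibbsDensity]
    rw [← exp_add]
    exact exp_le_exp.2 (by
      linarith [scaledCost_nonneg hη x y, scaledCost_le hη x y', h.symm.sub_le hη y y'])
  rw [h.integral_right, integral_const, probReal_univ, one_smul, exp_neg] at this
  rwa [inv_mul_le_iff₀ (exp_pos _), mul_one] at this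

lemma IsSchrodinger.le_gibbsDensity (hη : 0 ≤ η) {φ ψ : E →ᵇ ℝ} (h : IsSchrodinger η P Q φ ψ)
    (x y : E) : exp (-(2 * η)) ≤ gibbsDensity η φ ψ x y := by
  have : ∫ y', gibbsDensity η φ ψ x y' ∂Q ≤ ∫ _, exp (2 * η) * gibbsDensity η φ ψ x y ∂Q := by
    refine integral_mono (integrable_gibbsDensity hη φ ψ continuous_const continuous_id)
      (integrable_const _) fun y' => ?_
    simp only [gibbsDensity]
    rw [← exp_add]
    exact exp_le_exp.2 (by
      linarith [scaledCost_nonneg hη x y', scaledCost_le hη x y, h.symm.sub_le hη y' y])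
  rw [h.integral_right, integral_const, probReal_univ, one_smul] at this
  rw [exp_neg]
  exact inv_le_of_inv_le₀ (gibbsDensity_pos _ _ _ _ _)
    (by rwa [inv_le_iff_one_le_mul₀ (gibbsDensity_pos _ _ _ _ _)])

end Potentials

/-! ### The dual problem -/

section Dual

open Real BoundedContinuousFunction

/-- The exponential lies above its tangent at `0` by a quadratic gap, on any half-line bounded
below. -/
lemma one_add_add_sq_le_exp {R h : ℝ} (hR : 0 ≤ R) (hh : -R ≤ h) :
    1 + h + exp (-R) / 4 * h ^ 2 ≤ exp h := by
  -- With `u = exp (h / 2) - 1 ≥ h / 2` one has `exp h - 1 - h = u ^ 2 + 2 (u - h / 2) ≥ u ^ 2`.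
  have hu : exp h = exp (h / 2) ^ 2 := by rw [← exp_nat_mul]; ring_nf
  have hR2 : exp (-R) = exp (-R / 2) ^ 2 := by rw [← exp_nat_mul]; ring_nf
  have hu1 := add_one_le_exp (h / 2)
  have hpos := exp_pos (-R / 2)
  have hle : exp (-R / 2) ≤ 1 := exp_le_one_iff.2 (by linarith)
  have key : (exp (-R / 2) * (h / 2)) ^ 2 ≤ (exp (h / 2) - 1) ^ 2 := by
    rcases le_total 0 h with h0 | h0
    · refine pow_le_pow_left₀ (by positivity) ?_ 2
      nlinarith
    · have h1 : exp (h / 2) * exp (-(h / 2)) = 1 := by rw [← exp_add]; simp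
      have h2 := add_one_le_exp (-(h / 2))
      have h3 : exp (-R / 2) ≤ exp (h / 2) := exp_le_exp.2 (by linarith)
      have h4 : exp (-R / 2) * (-(h / 2)) ≤ 1 - exp (h / 2) := by
        calc exp (-R / 2) * (-(h / 2)) ≤ exp (h / 2) * (exp (-(h / 2)) - 1) := by
              have h5 : -(h / 2) ≤ exp (-(h / 2)) - 1 := by linarith
              gcongr
              linarith
          _ = _ := by rw [mul_sub, h1, mul_one]
      rw [← neg_sq, ← neg_sq (exp (h / 2) - 1)]
      refine pow_le_pow_left₀ (by nlinarith) (by linarith) 2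
  rw [hu, hR2]
  nlinarith

variable {E : Type*} [NormedAddCommGroup E] [MeasurableSpace E]

/-- The dual objective `∫ φ dP + ∫ ψ dQ - (∫∫ exp (φ + ψ - k) dP dQ - 1)` of entropic optimal
transport, in units of the regularization strength. -/
noncomputable def dualObjective (η : ℝ) (P Q : Measure E) (φ ψ : E →ᵇ ℝ) : ℝ :=
  ∫ x, φ x ∂P + ∫ y, ψ y ∂Q - (∫ z, gibbsDensity η φ ψ z.1 z.2 ∂(P.prod Q) - 1)

/-- The supremum of the dual objective over bounded continuous potentials. -/
noncomputable def dualValue (η : ℝ) (P Q : Measure E) : ℝ :=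
  ⨆ p : (E →ᵇ ℝ) × (E →ᵇ ℝ), dualObjective η P Q p.1 p.2

variable [BorelSpace E] [SecondCountableTopology E] {η : ℝ} {P Q : Measure E}
  [IsProbabilityMeasure P] [IsProbabilityMeasure Q]

lemma integral_prod_gibbsDensity (hη : 0 ≤ η) (φ ψ : E →ᵇ ℝ) :
    ∫ z, gibbsDensity η φ ψ z.1 z.2 ∂(P.prod Q) = ∫ x, ∫ y, gibbsDensity η φ ψ x y ∂Q ∂P :=
  integral_prod _ (integrable_gibbsDensity hη φ ψ continuous_fst continuous_snd)

lemma dualObjective_swap (hη : 0 ≤ η) (φ ψ : E →ᵇ ℝ) :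
    dualObjective η P Q φ ψ = dualObjective η Q P ψ φ := by
  rw [dualObjective, dualObjective, integral_prod_gibbsDensity hη, add_comm (∫ x, φ x ∂P),
    integral_prod_symm _ (integrable_gibbsDensity hη ψ φ continuous_fst continuous_snd)]
  simp only [gibbsDensity_swap η φ ψ]

lemma dualValue_comm (hη : 0 ≤ η) : dualValue η P Q = dualValue η Q P := by
  rw [dualValue, dualValue, ← (Equiv.prodComm (E →ᵇ ℝ) (E →ᵇ ℝ)).iSup_comp]
  exact iSup_congr fun _ => dualObjective_swap hη _ _

lemma dualObjective_of_integral_eq_one (hη : 0 ≤ η) {φ ψ : E →ᵇ ℝ}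
    (h : ∀ x, ∫ y, gibbsDensity η φ ψ x y ∂Q = 1) :
    dualObjective η P Q φ ψ = ∫ x, φ x ∂P + ∫ y, ψ y ∂Q := by
  simp [dualObjective, integral_prod_gibbsDensity hη, h]

omit [SecondCountableTopology E] in
lemma continuous_integral_gibbsDensity (hη : 0 ≤ η) (φ ψ : E →ᵇ ℝ) :
    Continuous fun x => ∫ y, gibbsDensity η φ ψ x y ∂Q := by
  have : ∀ x, ∫ y, gibbsDensity η φ ψ x y ∂Q = exp (φ x) * partitionFun η Q ψ x := fun x => by
    rw [partitionFun, ← integral_const_mul]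
    refine integral_congr_ae (Filter.Eventually.of_forall fun y => ?_)
    simp only [gibbsDensity]
    rw [← exp_add]; ring_nf
  simp_rw [this]
  exact (by fun_prop : Continuous fun x => exp (φ x)).mul (continuous_partitionFun hη ψ)

omit [SecondCountableTopology E] in
lemma abs_one_sub_integral_gibbsDensity_le (hη : 0 ≤ η) (φ ψ : E →ᵇ ℝ) (x : E) :
    |1 - ∫ y, gibbsDensity η φ ψ x y ∂Q| ≤ 1 + exp (‖φ‖ + ‖ψ‖) := by
  have h0 : 0 ≤ ∫ y, gibbsDensity η φ ψ x y ∂Q :=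
    integral_nonneg fun y => (gibbsDensity_pos _ _ _ _ _).le
  have h1 : ∫ y, gibbsDensity η φ ψ x y ∂Q ≤ ∫ _, exp (‖φ‖ + ‖ψ‖) ∂Q :=
    integral_mono (integrable_gibbsDensity hη φ ψ continuous_const continuous_id)
      (integrable_const _) fun y => gibbsDensity_le_exp_norm hη _ _ _ _
  rw [integral_const, probReal_univ, one_smul] at h1
  rw [abs_le]
  constructor <;> linarith [exp_pos (‖φ‖ + ‖ψ‖)]

lemma integral_prod_mul_gibbsDensity (hη : 0 ≤ η) (φ ψ a : E →ᵇ ℝ) :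
    ∫ z, a z.1 * gibbsDensity η φ ψ z.1 z.2 ∂(P.prod Q)
      = ∫ x, a x * ∫ y, gibbsDensity η φ ψ x y ∂Q ∂P := by
  rw [integral_prod]
  · simp_rw [integral_const_mul]
  · refine (integrable_gibbsDensity hη φ ψ continuous_fst continuous_snd).bdd_mul (c := ‖a‖)
      (by fun_prop) (Filter.Eventually.of_forall fun z => a.norm_coe_le_norm _)

lemma integral_prod_mul_gibbsDensity' (hη : 0 ≤ η) (φ ψ b : E →ᵇ ℝ) :
    ∫ z, b z.2 * gibbsDensity η φ ψ z.1 z.2 ∂(P.prod Q)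
      = ∫ y, b y * ∫ x, gibbsDensity η φ ψ x y ∂P ∂Q := by
  rw [integral_prod_symm]
  · simp_rw [integral_const_mul]
  · refine (integrable_gibbsDensity hη φ ψ continuous_fst continuous_snd).bdd_mul (c := ‖b‖)
      (by fun_prop) (Filter.Eventually.of_forall fun z => b.norm_coe_le_norm _)

/-- The dual objective lies below its linearization at `(φ, ψ)` by a quadratic gap, for increments
`(a, b)` with `a + b ≥ -R` and a starting density of at least `δ`. The factors of `a` and `b` in the
linear terms are the violations of the marginal constraints. -/
lemma dualObjective_add_le (hη : 0 ≤ η) (φ ψ a b : E →ᵇ ℝ) {R δ : ℝ} (hR : 0 ≤ R)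
    (hab : ∀ x y, -R ≤ a x + b y) (hg : ∀ x y, δ ≤ gibbsDensity η φ ψ x y) :
    dualObjective η P Q (φ + a) (ψ + b) ≤ dualObjective η P Q φ ψ
      + ∫ x, a x * (1 - ∫ y, gibbsDensity η φ ψ x y ∂Q) ∂P
      + ∫ y, b y * (1 - ∫ x, gibbsDensity η φ ψ x y ∂P) ∂Q
      - δ * exp (-R) / 4 * ∫ z, (a z.1 + b z.2) ^ 2 ∂(P.prod Q) := by
  set G : E × E → ℝ := fun z => gibbsDensity η φ ψ z.1 z.2 with hG
  have hGi : Integrable G (P.prod Q) :=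
    integrable_gibbsDensity hη φ ψ continuous_fst continuous_snd
  have hai : Integrable (fun z => a z.1 * G z) (P.prod Q) :=
    hGi.bdd_mul (c := ‖a‖) (by fun_prop)
      (Filter.Eventually.of_forall fun z => a.norm_coe_le_norm _)
  have hbi : Integrable (fun z => b z.2 * G z) (P.prod Q) :=
    hGi.bdd_mul (c := ‖b‖) (by fun_prop)
      (Filter.Eventually.of_forall fun z => b.norm_coe_le_norm _)
  have hsq : Integrable (fun z => (a z.1 + b z.2) ^ 2) (P.prod Q) := by
    refine integrable_of_continuous_of_abs_le (by fun_prop) ((‖a‖ + ‖b‖) ^ 2) fun z => ?_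
    rw [abs_pow]
    refine pow_le_pow_left₀ (abs_nonneg _) ((abs_add_le _ _).trans ?_) 2
    exact add_le_add (a.norm_coe_le_norm _) (b.norm_coe_le_norm _)
  have hle : ∫ z, (G z + (a z.1 * G z + b z.2 * G z)
        + δ * exp (-R) / 4 * (a z.1 + b z.2) ^ 2) ∂(P.prod Q)
      ≤ ∫ z, gibbsDensity η (φ + a) (ψ + b) z.1 z.2 ∂(P.prod Q) := by
    refine integral_mono ((hGi.add (hai.add hbi)).add (hsq.const_mul _))
      (integrable_gibbsDensity hη _ _ continuous_fst continuous_snd) fun z => ?_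
    have h1 := one_add_add_sq_le_exp hR (hab z.1 z.2)
    have h2 : gibbsDensity η (φ + a) (ψ + b) z.1 z.2 = G z * exp (a z.1 + b z.2) := by
      simp only [hG, gibbsDensity, BoundedContinuousFunction.coe_add, Pi.add_apply]
      rw [← exp_add]; ring_nf
    have h3 : 0 ≤ G z := (gibbsDensity_pos _ _ _ _ _).le
    have h4 : δ * (exp (-R) / 4 * (a z.1 + b z.2) ^ 2)
        ≤ G z * (exp (-R) / 4 * (a z.1 + b z.2) ^ 2) := by
      gcongr
      exact hg _ _
    simp only [h2]
    nlinarith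
  have habi : Integrable (fun z => a z.1 * G z + b z.2 * G z) (P.prod Q) := hai.add hbi
  have hGabi : Integrable (fun z => G z + (a z.1 * G z + b z.2 * G z)) (P.prod Q) :=
    hGi.add habi
  rw [integral_add hGabi (hsq.const_mul _), integral_add hGi habi, integral_add hai hbi,
    integral_const_mul, integral_prod_mul_gibbsDensity hη,
    integral_prod_mul_gibbsDensity' hη] at hle
  have hbdd (c : E →ᵇ ℝ) (S S' : Measure E) [IsProbabilityMeasure S] [IsProbabilityMeasure S']
      (φ ψ : E →ᵇ ℝ) : ∫ x, c x * (1 - ∫ y, gibbsDensity η φ ψ x y ∂S) ∂S'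
        = ∫ x, c x ∂S' - ∫ x, c x * ∫ y, gibbsDensity η φ ψ x y ∂S ∂S' := by
    rw [← integral_sub (c.integrable _)]
    · simp only [mul_sub, mul_one]
    · refine (c.integrable S').mul_bdd (c := 2 + exp (‖φ‖ + ‖ψ‖))
        (continuous_integral_gibbsDensity hη _ _).measurable.aestronglyMeasurable
        (Filter.Eventually.of_forall fun x => ?_)
      have := abs_le.1 (abs_one_sub_integral_gibbsDensity_le (Q := S) hη φ ψ x)
      rw [Real.norm_eq_abs, abs_le]
      constructor <;> linarith [exp_pos (‖φ‖ + ‖ψ‖)]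
  have hB := hbdd b P Q ψ φ
  simp only [gibbsDensity_swap η ψ φ] at hB
  rw [hbdd a Q P φ ψ, hB, dualObjective, dualObjective]
  simp only [BoundedContinuousFunction.coe_add, Pi.add_apply]
  rw [integral_add (φ.integrable _) (a.integrable _), integral_add (ψ.integrable _)
    (b.integrable _)]
  linarith

/-- Schrödinger potentials maximize the dual objective: they are critical points of a concave
functional. -/
lemma IsSchrodinger.dualObjective_le (hη : 0 ≤ η) {φ ψ : E →ᵇ ℝ} (h : IsSchrodinger η P Q φ ψ)
    (φ' ψ' : E →ᵇ ℝ) : dualObjective η P Q φ' ψ' ≤ dualObjective η P Q φ ψ := by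
  have := dualObjective_add_le (P := P) (Q := Q) hη φ ψ (φ' - φ) (ψ' - ψ)
    (R := ‖φ' - φ‖ + ‖ψ' - ψ‖) (δ := 0) (by positivity)
    (fun x y => by linarith [(abs_le.1 ((φ' - φ).norm_coe_le_norm x)).1,
      (abs_le.1 ((ψ' - ψ).norm_coe_le_norm y)).1])
    (fun x y => (gibbsDensity_pos _ _ _ _ _).le)
  simpa [h.integral_left, h.integral_right] using this

lemma bddAbove_range_dualObjective (hη : 0 ≤ η) : BddAbove
    (Set.range fun p : (E →ᵇ ℝ) × (E →ᵇ ℝ) => dualObjective η P Q p.1 p.2) := by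
  obtain ⟨φ, ψ, h⟩ := exists_isSchrodinger P Q hη
  exact ⟨dualObjective η P Q φ ψ, by rintro _ ⟨p, rfl⟩; exact h.dualObjective_le hη _ _⟩

lemma dualObjective_le_dualValue (hη : 0 ≤ η) (φ ψ : E →ᵇ ℝ) :
    dualObjective η P Q φ ψ ≤ dualValue η P Q :=
  le_ciSup (bddAbove_range_dualObjective hη) (φ, ψ)

lemma IsSchrodinger.dualValue_eq (hη : 0 ≤ η) {φ ψ : E →ᵇ ℝ} (h : IsSchrodinger η P Q φ ψ) :
    dualValue η P Q = dualObjective η P Q φ ψ :=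
  le_antisymm (ciSup_le fun _ => h.dualObjective_le hη _ _) (dualObjective_le_dualValue hη φ ψ)

lemma IsSchrodinger.dualValue_eq_integral (hη : 0 ≤ η) {φ ψ : E →ᵇ ℝ}
    (h : IsSchrodinger η P Q φ ψ) : dualValue η P Q = ∫ x, φ x ∂P + ∫ y, ψ y ∂Q := by
  rw [h.dualValue_eq hη, dualObjective_of_integral_eq_one hη h.integral_right]

lemma abs_dualValue_le (hη : 0 ≤ η) : |dualValue η P Q| ≤ 3 * η := by
  obtain ⟨φ, ψ, h⟩ := exists_isSchrodinger P Q hη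
  have hφ : Integrable (fun z : E × E => φ z.1) (P.prod Q) := (φ.integrable P).comp_fst Q
  have hψ : Integrable (fun z : E × E => ψ z.2) (P.prod Q) := (ψ.integrable Q).comp_snd P
  have he : ∫ z, (φ z.1 + ψ z.2) ∂(P.prod Q) = ∫ x, φ x ∂P + ∫ y, ψ y ∂Q := by
    rw [integral_add hφ hψ, integral_fun_fst, integral_fun_snd]
    simp
  rw [h.dualValue_eq_integral hη, ← he, ← Real.norm_eq_abs]
  refine (norm_integral_le_of_norm_le_const (C := 3 * η)
    (Filter.Eventually.of_forall fun z => ?_)).trans_eq (by simp)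
  have h1 := exp_le_exp.1 (h.gibbsDensity_le hη z.1 z.2)
  have h2 := exp_le_exp.1 (h.le_gibbsDensity hη z.1 z.2)
  rw [Real.norm_eq_abs, abs_le]
  constructor <;> linarith [scaledCost_nonneg hη z.1 z.2, scaledCost_le hη z.1 z.2]

/-- A Polyak–Łojasiewicz inequality: the dual suboptimality of potentials with a density between
`exp (-2η)` and `exp (2η)` is controlled by the squared norm of the gradient, that is, by the
violation of the marginal constraints. -/
theorem dualValue_le_add_marginal_error (hη : 0 ≤ η) {φ ψ : E →ᵇ ℝ}
    (hlb : ∀ x y, exp (-(2 * η)) ≤ gibbsDensity η φ ψ x y)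
    (hub : ∀ x y, gibbsDensity η φ ψ x y ≤ exp (2 * η)) :
    dualValue η P Q ≤ dualObjective η P Q φ ψ + exp (6 * η) *
      (∫ x, (1 - ∫ y, gibbsDensity η φ ψ x y ∂Q) ^ 2 ∂P
        + ∫ y, (1 - ∫ x, gibbsDensity η φ ψ x y ∂P) ^ 2 ∂Q) := by
  obtain ⟨φ', ψ', h⟩ := exists_isSchrodinger P Q hη
  -- Among the potentials `(φ' + m, ψ' - m)`, which all have the same density, `m` is chosen so that
  -- the second increment has mean zero; then `∫ (a + b)² = ∫ a² + ∫ b²`.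
  set m := ∫ y, (ψ' - ψ) y ∂Q with hm
  set a : E →ᵇ ℝ := φ' - φ + BoundedContinuousFunction.const E m with ha
  set b : E →ᵇ ℝ := ψ' - ψ - BoundedContinuousFunction.const E m with hb
  have hb0 : ∫ y, b y ∂Q = 0 := by
    have : ∫ y, b y ∂Q = ∫ y, ((ψ' - ψ) y - m) ∂Q := rfl
    rw [this, integral_sub ((ψ' - ψ).integrable _) (integrable_const _)]
    simp [hm]
  have hab (x y : E) : a x + b y = (φ' x + ψ' y) - (φ x + ψ y) := by
    simp only [ha, hb, BoundedContinuousFunction.coe_add, BoundedContinuousFunction.coe_sub,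
      Pi.add_apply, Pi.sub_apply, BoundedContinuousFunction.const_apply]
    ring
  have hdual : dualValue η P Q = dualObjective η P Q (φ + a) (ψ + b) := by
    have e1 : φ + a = φ' + BoundedContinuousFunction.const E m := by rw [ha]; abel
    have e2 : ψ + b = ψ' - BoundedContinuousFunction.const E m := by rw [hb]; abel
    have hg (x y : E) : gibbsDensity η (φ + a) (ψ + b) x y = gibbsDensity η φ' ψ' x y := by
      rw [e1, e2]
      simp [gibbsDensity]
    have h' : IsSchrodinger η P Q (φ + a) (ψ + b) :=
      ⟨fun x => by simpa only [hg] using h.integral_right x,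
        fun y => by simpa only [hg] using h.integral_left y⟩
    exact h'.dualValue_eq hη
  have hmain := dualObjective_add_le (P := P) (Q := Q) hη φ ψ a b (R := 4 * η)
    (δ := exp (-(2 * η))) (by positivity) (fun x y => by
      have h1 := exp_le_exp.1 (h.le_gibbsDensity hη x y)
      have h2 := exp_le_exp.1 (hub x y)
      rw [hab]
      linarith) hlb
  have hα : exp (-(2 * η)) * exp (-(4 * η)) = exp (-(6 * η)) := by rw [← exp_add]; ring_nf
  have hsqi (c : E →ᵇ ℝ) (S : Measure E) [IsProbabilityMeasure S] :
      Integrable (fun x => c x ^ 2) S :=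
    integrable_of_continuous_of_abs_le (by fun_prop) (‖c‖ ^ 2) fun z => by
      rw [abs_pow]
      exact pow_le_pow_left₀ (abs_nonneg _) (c.norm_coe_le_norm _) 2
  have hsq : ∫ z, (a z.1 + b z.2) ^ 2 ∂(P.prod Q) = ∫ x, a x ^ 2 ∂P + ∫ y, b y ^ 2 ∂Q := by
    have i1 : Integrable (fun z : E × E => a z.1 ^ 2) (P.prod Q) := (hsqi a P).comp_fst Q
    have i2 : Integrable (fun z : E × E => b z.2 ^ 2) (P.prod Q) := (hsqi b Q).comp_snd P
    have i3 : Integrable (fun z : E × E => a z.1 * b z.2) (P.prod Q) :=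
      (a.integrable P).mul_prod (b.integrable Q)
    have e : ∀ z : E × E, (a z.1 + b z.2) ^ 2 = a z.1 ^ 2 + b z.2 ^ 2 + 2 * (a z.1 * b z.2) :=
      fun z => by ring
    simp_rw [e]
    have i12 : Integrable (fun z : E × E => a z.1 ^ 2 + b z.2 ^ 2) (P.prod Q) := i1.add i2
    rw [integral_add i12 (i3.const_mul 2), integral_add i1 i2, integral_const_mul,
      integral_prod_mul (fun x => a x) (fun y => b y), hb0,
      integral_fun_fst (fun x => a x ^ 2), integral_fun_snd (fun y => b y ^ 2)]
    simp
  have hopt (c : E →ᵇ ℝ) (S : Measure E) [IsProbabilityMeasure S] (A : E → ℝ)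
      (hA : Continuous A) (K : ℝ) (hK : ∀ x, |A x| ≤ K) :
      ∫ x, c x * A x ∂S - exp (-(6 * η)) / 4 * ∫ x, c x ^ 2 ∂S
        ≤ exp (6 * η) * ∫ x, A x ^ 2 ∂S := by
    have j1 : Integrable (fun x => c x * A x) S :=
      (c.integrable S).mul_bdd (c := K) hA.measurable.aestronglyMeasurable
        (Filter.Eventually.of_forall hK)
    have j2 : Integrable (fun x => A x ^ 2) S :=
      integrable_of_continuous_of_abs_le (by fun_prop) (K ^ 2) fun z => by
        rw [abs_pow]
        exact pow_le_pow_left₀ (abs_nonneg _) (hK _) 2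
    rw [← integral_const_mul, ← integral_const_mul, ← integral_sub j1 ((hsqi c S).const_mul _)]
    refine integral_mono (j1.sub ((hsqi c S).const_mul _)) (j2.const_mul _) fun x => ?_
    have he : exp (6 * η) * exp (-(6 * η)) = 1 := by rw [← exp_add]; simp
    have h1 : 0 ≤ exp (6 * η) * (A x - exp (-(6 * η)) / 2 * c x) ^ 2 := by positivity
    have h2 : exp (6 * η) * (A x - exp (-(6 * η)) / 2 * c x) ^ 2
        = exp (6 * η) * A x ^ 2 - (exp (6 * η) * exp (-(6 * η))) * (c x * A x)
          + (exp (6 * η) * exp (-(6 * η))) * (exp (-(6 * η)) / 4 * c x ^ 2) := by ring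
    rw [h2, he] at h1
    simp only
    linarith
  have hA := hopt a P (fun x => 1 - ∫ y, gibbsDensity η φ ψ x y ∂Q)
    (continuous_const.sub (continuous_integral_gibbsDensity hη φ ψ)) _
    (abs_one_sub_integral_gibbsDensity_le hη φ ψ)
  have hB := hopt b Q (fun y => 1 - ∫ x, gibbsDensity η ψ φ y x ∂P)
    (continuous_const.sub (continuous_integral_gibbsDensity hη ψ φ)) _
    (abs_one_sub_integral_gibbsDensity_le hη ψ φ)
  simp only [gibbsDensity_swap η ψ φ] at hB
  rw [hα, hsq] at hmain
  rw [hdual]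
  linarith

/-! ### Empirical measures -/

omit [BorelSpace E] [SecondCountableTopology E] [NormedAddCommGroup E] in
lemma isProbabilityMeasure_empiricalMeasure {n : ℕ} (hn : n ≠ 0) (x : Fin n → E) :
    IsProbabilityMeasure (empiricalMeasure x) := by
  constructor
  simp only [empiricalMeasure, Measure.smul_apply, Measure.finsetSum_apply, measure_univ,
    Finset.sum_const, Finset.card_univ, Fintype.card_fin, nsmul_eq_mul, mul_one, smul_eq_mul]
  exact ENNReal.inv_mul_cancel (by simpa using hn) (by simp)

lemma integral_empiricalMeasure {n : ℕ} (x : Fin n → E) (f : E → ℝ) :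
    ∫ z, f z ∂(empiricalMeasure x) = (n : ℝ)⁻¹ * ∑ i, f (x i) := by
  rw [empiricalMeasure, integral_smul_measure, integral_finsetSum_measure]
  · simp [integral_dirac]
  · intro i _
    exact integrable_dirac (by simp)

/-- Changing one sample point changes the dual value by at most `η / n`: the potentials that are
optimal before the change satisfy one marginal constraint everywhere, so they remain admissible
with an explicit dual objective, and their oscillation is at most `η`. -/
lemma dualValue_empiricalMeasure_sub_le (hη : 0 ≤ η) {n : ℕ} (hn : n ≠ 0) (x x' y : Fin n → E)
    (i : Fin n) (hx : ∀ j, j ≠ i → x j = x' j) :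
    dualValue η (empiricalMeasure x) (empiricalMeasure y)
      - dualValue η (empiricalMeasure x') (empiricalMeasure y) ≤ η / n := by
  have := isProbabilityMeasure_empiricalMeasure hn x
  have := isProbabilityMeasure_empiricalMeasure hn x'
  have := isProbabilityMeasure_empiricalMeasure hn y
  obtain ⟨φ, ψ, h⟩ := exists_isSchrodinger (empiricalMeasure x) (empiricalMeasure y) hη
  have h1 := dualObjective_le_dualValue (P := empiricalMeasure x') (Q := empiricalMeasure y) hη φ ψ
  rw [dualObjective_of_integral_eq_one hη h.integral_right] at h1
  have h2 : ∑ j, φ (x j) - ∑ j, φ (x' j) = φ (x i) - φ (x' i) := by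
    rw [← Finset.sum_sub_distrib]
    refine Finset.sum_eq_single i (fun j _ hj => ?_) (by simp)
    rw [hx j hj, sub_self]
  have h3 := h.sub_le hη (x i) (x' i)
  have h4 : ∫ z, φ z ∂(empiricalMeasure x) - ∫ z, φ z ∂(empiricalMeasure x')
      = (φ (x i) - φ (x' i)) / n := by
    rw [integral_empiricalMeasure, integral_empiricalMeasure, ← mul_sub, h2]
    ring
  have h5 : (φ (x i) - φ (x' i)) / n ≤ η / n := by gcongr
  rw [h.dualValue_eq_integral hη]
  linarith

lemma abs_dualValue_empiricalMeasure_sub_le (hη : 0 ≤ η) {n : ℕ} (hn : n ≠ 0)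
    (x x' y : Fin n → E) (i : Fin n) (hx : ∀ j, j ≠ i → x j = x' j) :
    |dualValue η (empiricalMeasure x) (empiricalMeasure y)
      - dualValue η (empiricalMeasure x') (empiricalMeasure y)| ≤ η / n := by
  rw [abs_sub_le_iff]
  exact ⟨dualValue_empiricalMeasure_sub_le hη hn x x' y i hx,
    dualValue_empiricalMeasure_sub_le hη hn x' x y i fun j hj => (hx j hj).symm⟩

lemma dualObjective_empiricalMeasure (hη : 0 ≤ η) {n : ℕ} (hn : n ≠ 0) (x y : Fin n → E)
    (φ ψ : E →ᵇ ℝ) : dualObjective η (empiricalMeasure x) (empiricalMeasure y) φ ψ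
      = (n : ℝ)⁻¹ * ∑ i, φ (x i) + (n : ℝ)⁻¹ * ∑ j, ψ (y j)
        - ((n : ℝ)⁻¹ * ∑ i, ((n : ℝ)⁻¹ * ∑ j, gibbsDensity η φ ψ (x i) (y j)) - 1) := by
  have := isProbabilityMeasure_empiricalMeasure hn x
  have := isProbabilityMeasure_empiricalMeasure hn y
  rw [dualObjective, integral_prod_gibbsDensity hη]
  simp only [integral_empiricalMeasure]

/-- As a supremum of continuous functions of the sample, the empirical dual value is lower
semicontinuous. -/
lemma measurable_dualValue_empiricalMeasure (hη : 0 ≤ η) {n : ℕ} (hn : n ≠ 0) :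
    Measurable fun p : (Fin n → E) × (Fin n → E) =>
      dualValue η (empiricalMeasure p.1) (empiricalMeasure p.2) := by
  refine LowerSemicontinuous.measurable ?_
  refine lowerSemicontinuous_ciSup (fun p => ?_) fun q => ?_
  · have := isProbabilityMeasure_empiricalMeasure hn p.1
    have := isProbabilityMeasure_empiricalMeasure hn p.2
    exact bddAbove_range_dualObjective hη
  · simp only [dualObjective_empiricalMeasure hη hn]
    exact Continuous.lowerSemicontinuous (by fun_prop)

end Dual

/-! ### Strong duality -/

section Duality

open Real BoundedContinuousFunction

/-- The Legendre-type lower bound for the Kullback–Leibler divergence against a bounded test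
function, from Young's inequality `r f ≤ (r log r - r) + exp f`. -/
lemma integral_sub_integral_exp_le_integral_klFun {X : Type*} [MeasurableSpace X]
    {γ ρ : Measure X} [IsFiniteMeasure γ] [IsProbabilityMeasure ρ] (hac : γ ≪ ρ)
    (hllr : Integrable (llr γ ρ) γ) {f : X → ℝ} (hf : Measurable f) {C : ℝ}
    (hC : ∀ x, |f x| ≤ C) :
    ∫ x, f x ∂γ - (∫ x, exp (f x) ∂ρ - 1) ≤ ∫ x, klFun (γ.rnDeriv ρ x).toReal ∂ρ := by
  have hexp : Integrable (fun x => exp (f x)) ρ := by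
    refine Integrable.of_bound (by fun_prop) (exp C) (Filter.Eventually.of_forall fun x => ?_)
    rw [Real.norm_eq_abs, abs_exp]
    exact exp_le_exp.2 (abs_le.1 (hC x)).2
  have hr : Integrable (fun x => (γ.rnDeriv ρ x).toReal * f x) ρ :=
    Measure.integrable_toReal_rnDeriv.mul_bdd (c := C) hf.aestronglyMeasurable
      (Filter.Eventually.of_forall hC)
  have hint : ∫ x, f x ∂γ = ∫ x, (γ.rnDeriv ρ x).toReal * f x ∂ρ :=
    (integral_rnDeriv_smul hac).symm
  have hone : ∫ x, exp (f x) ∂ρ - 1 = ∫ x, (exp (f x) - 1) ∂ρ := by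
    rw [integral_sub hexp (integrable_const _)]
    simp
  have hexp1 : Integrable (fun x => exp (f x) - 1) ρ := hexp.sub (integrable_const _)
  rw [hint, hone, ← integral_sub hr hexp1]
  refine integral_mono (hr.sub hexp1)
    ((integrable_klFun_rnDeriv_iff hac).2 hllr) fun x => ?_
  simp only [klFun_apply]
  have hr0 : 0 ≤ (γ.rnDeriv ρ x).toReal := ENNReal.toReal_nonneg
  rcases hr0.eq_or_lt with h0 | h0
  · rw [← h0]
    simp only [zero_mul]
    linarith [exp_pos (f x)]
  · have h1 := add_one_le_exp (f x - log (γ.rnDeriv ρ x).toReal)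
    rw [exp_sub, exp_log h0, le_div_iff₀ h0] at h1
    nlinarith

variable {E : Type*} [NormedAddCommGroup E] [MeasurableSpace E] [BorelSpace E]
  [SecondCountableTopology E] {η : ℝ} {P Q : Measure E}
  [IsProbabilityMeasure P] [IsProbabilityMeasure Q]

omit [NormedAddCommGroup E] [BorelSpace E] [SecondCountableTopology E]
  [IsProbabilityMeasure Q] in
lemma isProbabilityMeasure_of_mem_couplings {γ : Measure (E × E)} (hγ : γ ∈ couplings P Q) :
    IsProbabilityMeasure γ := by
  constructor
  rw [← Set.preimage_univ (f := Prod.fst), ← Measure.map_apply measurable_fst MeasurableSet.univ,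
    hγ.1, measure_univ]

/-- On the ball of radius `1 / 2` the truncated cost is the quadratic cost, so the entropic
objective of a coupling with finite divergence is a real number in which the truncated cost
appears. -/
lemma entropicObjective_eq_ofReal (hη : 0 < η) (hP : ∀ᵐ x ∂P, ‖x‖ ≤ 1 / 2)
    (hQ : ∀ᵐ y ∂Q, ‖y‖ ≤ 1 / 2) {γ : Measure (E × E)} (hγ : γ ∈ couplings P Q)
    (hac : γ ≪ P.prod Q) (hllr : Integrable (llr γ (P.prod Q)) γ) :
    entropicObjective η P Q γ = ENNReal.ofReal ((∫ z, scaledCost η z.1 z.2 ∂γ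
      + ∫ z, klFun (γ.rnDeriv (P.prod Q) z).toReal ∂(P.prod Q)) / η) := by
  have := isProbabilityMeasure_of_mem_couplings hγ
  have h1 : ∀ᵐ z ∂γ, ‖z.1‖ ≤ 1 / 2 :=
    ae_of_ae_map measurable_fst.aemeasurable (by rw [hγ.1]; exact hP)
  have h2 : ∀ᵐ z ∂γ, ‖z.2‖ ≤ 1 / 2 :=
    ae_of_ae_map measurable_snd.aemeasurable (by rw [hγ.2]; exact hQ)
  have hint : Integrable (fun z : E × E => scaledCost η z.1 z.2 / η) γ := by
    refine (integrable_of_continuous_of_abs_le (by fun_prop) η fun z => ?_).div_const _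
    rw [abs_of_nonneg (scaledCost_nonneg hη.le _ _)]
    exact scaledCost_le hη.le _ _
  have h3 : ∫⁻ z, ENNReal.ofReal (‖z.1 - z.2‖ ^ 2) ∂γ
      = ENNReal.ofReal ((∫ z, scaledCost η z.1 z.2 ∂γ) / η) := by
    rw [← integral_div, ofReal_integral_eq_lintegral_ofReal hint
      (Filter.Eventually.of_forall fun z => div_nonneg (scaledCost_nonneg hη.le _ _) hη.le)]
    refine lintegral_congr_ae ?_
    filter_upwards [h1, h2] with z hz1 hz2
    rw [scaledCost_of_norm_le hz1 hz2, mul_div_cancel_left₀ _ hη.ne']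
  have h4 : 0 ≤ ∫ z, scaledCost η z.1 z.2 ∂γ :=
    integral_nonneg fun z => scaledCost_nonneg hη.le _ _
  have h5 : 0 ≤ ∫ z, klFun (γ.rnDeriv (P.prod Q) z).toReal ∂(P.prod Q) :=
    integral_nonneg fun z => klFun_nonneg ENNReal.toReal_nonneg
  rw [entropicObjective, h3, klDiv_eq_integral_klFun, if_pos ⟨hac, hllr⟩,
    ← ENNReal.ofReal_mul (by positivity), ← ENNReal.ofReal_add (by positivity) (by positivity)]
  congr 1
  ring

/-- The Gibbs measure with density `exp (φ + ψ - k)` relative to `P ⊗ Q`. -/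
noncomputable def gibbsMeasure (η : ℝ) (P Q : Measure E) (φ ψ : E →ᵇ ℝ) : Measure (E × E) :=
  (P.prod Q).withDensity fun z => ENNReal.ofReal (gibbsDensity η φ ψ z.1 z.2)

lemma measurable_gibbsDensity (φ ψ : E →ᵇ ℝ) :
    Measurable fun z : E × E => gibbsDensity η φ ψ z.1 z.2 :=
  (by fun_prop : Continuous fun z : E × E => gibbsDensity η φ ψ z.1 z.2).measurable

/-- The Gibbs measure of Schrödinger potentials is a coupling. -/
lemma IsSchrodinger.gibbsMeasure_mem_couplings (hη : 0 ≤ η) {φ ψ : E →ᵇ ℝ}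
    (h : IsSchrodinger η P Q φ ψ) : gibbsMeasure η P Q φ ψ ∈ couplings P Q := by
  have hmeas : Measurable fun z : E × E => ENNReal.ofReal (gibbsDensity η φ ψ z.1 z.2) :=
    (measurable_gibbsDensity φ ψ).ennreal_ofReal
  have hone {S : Measure E} [IsProbabilityMeasure S] {f : E → ℝ} (hf : Integrable f S)
      (h0 : ∀ x, 0 ≤ f x) (h1 : ∫ x, f x ∂S = 1) : ∫⁻ x, ENNReal.ofReal (f x) ∂S = 1 := by
    rw [← ofReal_integral_eq_lintegral_ofReal hf (Filter.Eventually.of_forall h0), h1,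
      ENNReal.ofReal_one]
  constructor
  · ext s hs
    rw [Measure.map_apply measurable_fst hs, gibbsMeasure,
      withDensity_apply _ (measurable_fst hs), ← Set.prod_univ, ← Measure.prod_restrict,
      Measure.restrict_univ, lintegral_prod _ hmeas.aemeasurable]
    have (x : E) : ∫⁻ y, ENNReal.ofReal (gibbsDensity η φ ψ x y) ∂Q = 1 :=
      hone (integrable_gibbsDensity hη φ ψ continuous_const continuous_id)
        (fun y => (gibbsDensity_pos _ _ _ _ _).le) (h.integral_right x)
    simp [this]
  · ext s hs
    rw [Measure.map_apply measurable_snd hs, gibbsMeasure,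
      withDensity_apply _ (measurable_snd hs), ← Set.univ_prod, ← Measure.prod_restrict,
      Measure.restrict_univ, lintegral_prod_symm _ hmeas.aemeasurable]
    have (y : E) : ∫⁻ x, ENNReal.ofReal (gibbsDensity η φ ψ x y) ∂P = 1 :=
      hone (integrable_gibbsDensity hη φ ψ continuous_id continuous_const)
        (fun x => (gibbsDensity_pos _ _ _ _ _).le) (h.integral_left y)
    simp [this]

omit [IsProbabilityMeasure Q] in
lemma integral_couplings_add {γ : Measure (E × E)} (hγ : γ ∈ couplings P Q) (φ ψ : E →ᵇ ℝ) :
    ∫ z, (φ z.1 + ψ z.2) ∂γ = ∫ x, φ x ∂P + ∫ y, ψ y ∂Q := by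
  have := isProbabilityMeasure_of_mem_couplings hγ
  rw [integral_add, ← hγ.1, ← hγ.2, integral_map measurable_fst.aemeasurable (by fun_prop),
    integral_map measurable_snd.aemeasurable (by fun_prop)]
  · exact integrable_of_continuous_of_abs_le (by fun_prop) ‖φ‖ fun z => φ.norm_coe_le_norm _
  · exact integrable_of_continuous_of_abs_le (by fun_prop) ‖ψ‖ fun z => ψ.norm_coe_le_norm _

/-- Strong duality: for measures on the ball of radius `1 / 2` the entropic cost is the dual value,
which is attained by the Gibbs coupling of Schrödinger potentials. -/
theorem entropicCost_eq_dualValue_div (hη : 0 < η) (hP : ∀ᵐ x ∂P, ‖x‖ ≤ 1 / 2)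
    (hQ : ∀ᵐ y ∂Q, ‖y‖ ≤ 1 / 2) : entropicCost η P Q = dualValue η P Q / η := by
  obtain ⟨φ, ψ, h⟩ := exists_isSchrodinger P Q hη.le
  set f : E × E → ℝ := fun z => φ z.1 + ψ z.2 - scaledCost η z.1 z.2 with hf
  have hfm : Measurable f := (by fun_prop : Continuous f).measurable
  have hfb : ∀ z, |f z| ≤ 2 * η := fun z => by
    have h1 := exp_le_exp.1 (h.gibbsDensity_le hη.le z.1 z.2)
    have h2 := exp_le_exp.1 (h.le_gibbsDensity hη.le z.1 z.2)
    exact abs_le.2 ⟨by linarith, h1⟩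
  have hfint {γ : Measure (E × E)} (hγ : γ ∈ couplings P Q) :
      ∫ z, f z ∂γ = dualValue η P Q - ∫ z, scaledCost η z.1 z.2 ∂γ := by
    have := isProbabilityMeasure_of_mem_couplings hγ
    have hk : Integrable (fun z : E × E => scaledCost η z.1 z.2) γ :=
      integrable_of_continuous_of_abs_le (by fun_prop) η fun z => by
        rw [abs_of_nonneg (scaledCost_nonneg hη.le _ _)]
        exact scaledCost_le hη.le _ _
    have hs : Integrable (fun z : E × E => φ z.1 + ψ z.2) γ :=
      integrable_of_continuous_of_abs_le (by fun_prop) (‖φ‖ + ‖ψ‖) fun z =>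
        (abs_add_le _ _).trans (add_le_add (φ.norm_coe_le_norm _) (ψ.norm_coe_le_norm _))
    rw [h.dualValue_eq_integral hη.le, ← integral_couplings_add hγ, ← integral_sub hs hk]
  have hmass : ∫ z, exp (f z) ∂(P.prod Q) = 1 := by
    have := integral_prod_gibbsDensity (P := P) (Q := Q) hη.le φ ψ
    simp only [h.integral_right, integral_const, probReal_univ, one_smul] at this
    exact this
  have hlower : ENNReal.ofReal (dualValue η P Q / η) ≤ entropicCostENN η P Q := by
    refine le_iInf₂ fun γ hγ => ?_
    have := isProbabilityMeasure_of_mem_couplings hγ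
    by_cases htop : klDiv γ (P.prod Q) = ∞
    · have : ENNReal.ofReal (1 / η) ≠ 0 := by simpa using hη
      rw [entropicObjective, htop, ENNReal.mul_top this, add_top]
      exact le_top
    · obtain ⟨hac, hllr⟩ := klDiv_ne_top_iff.1 htop
      rw [entropicObjective_eq_ofReal hη hP hQ hγ hac hllr]
      refine ENNReal.ofReal_le_ofReal ?_
      have h1 := integral_sub_integral_exp_le_integral_klFun hac hllr hfm hfb
      rw [hmass, hfint hγ] at h1
      gcongr
      linarith
  have hupper : entropicCostENN η P Q ≤ ENNReal.ofReal (dualValue η P Q / η) := by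
    have hγ := h.gibbsMeasure_mem_couplings hη.le
    have := isProbabilityMeasure_of_mem_couplings hγ
    have hac : gibbsMeasure η P Q φ ψ ≪ P.prod Q := withDensity_absolutelyContinuous _ _
    have hrn : (gibbsMeasure η P Q φ ψ).rnDeriv (P.prod Q) =ᵐ[P.prod Q]
        fun z => ENNReal.ofReal (exp (f z)) :=
      Measure.rnDeriv_withDensity _ (measurable_gibbsDensity φ ψ).ennreal_ofReal
    have hkl : (fun z => klFun ((gibbsMeasure η P Q φ ψ).rnDeriv (P.prod Q) z).toReal)
        =ᵐ[P.prod Q] fun z => exp (f z) * f z + 1 - exp (f z) := by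
      filter_upwards [hrn] with z hz
      rw [hz, ENNReal.toReal_ofReal (exp_pos _).le, klFun_apply, log_exp]
    have he : Integrable (fun z => exp (f z)) (P.prod Q) :=
      integrable_gibbsDensity hη.le φ ψ continuous_fst continuous_snd
    have hef : Integrable (fun z => exp (f z) * f z) (P.prod Q) :=
      he.mul_bdd (c := 2 * η) hfm.aestronglyMeasurable (Filter.Eventually.of_forall hfb)
    have he1 : Integrable (fun z => exp (f z) * f z + 1) (P.prod Q) :=
      hef.add (integrable_const _)
    have hllr : Integrable (llr (gibbsMeasure η P Q φ ψ) (P.prod Q)) (gibbsMeasure η P Q φ ψ) := by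
      rw [← integrable_klFun_rnDeriv_iff hac, integrable_congr hkl]
      exact he1.sub he
    have hef' : ∫ z, exp (f z) * f z ∂(P.prod Q) = ∫ z, f z ∂(gibbsMeasure η P Q φ ψ) := by
      rw [gibbsMeasure, integral_withDensity_eq_integral_toReal_smul
        (measurable_gibbsDensity φ ψ).ennreal_ofReal
        (Filter.Eventually.of_forall fun _ => ENNReal.ofReal_lt_top)]
      refine integral_congr_ae (Filter.Eventually.of_forall fun z => ?_)
      simp only [ENNReal.toReal_ofReal (gibbsDensity_pos _ _ _ _ _).le, smul_eq_mul]
      rfl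
    refine (iInf₂_le _ hγ).trans_eq ?_
    rw [entropicObjective_eq_ofReal hη hP hQ hγ hac hllr, integral_congr_ae hkl,
      integral_sub he1 he, integral_add hef (integrable_const _), hmass, hef', hfint hγ]
    congr 2
    simp
  have hnonneg : 0 ≤ dualValue η P Q := by
    refine le_trans ?_ (dualObjective_le_dualValue hη.le 0 0)
    have hle : ∫ z, gibbsDensity η 0 0 z.1 z.2 ∂(P.prod Q) ≤ ∫ _, 1 ∂(P.prod Q) := by
      refine integral_mono (integrable_gibbsDensity hη.le 0 0 continuous_fst continuous_snd)
        (integrable_const _) fun z => ?_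
      simpa using gibbsDensity_le_exp_norm hη.le (0 : E →ᵇ ℝ) 0 z.1 z.2
    simp only [integral_const, probReal_univ, one_smul] at hle
    simp [dualObjective, hle]
  rw [entropicCost, le_antisymm hupper hlower, ENNReal.toReal_ofReal (by positivity)]

end Duality

/-! ### Concentration of functions with bounded differences -/

section Concentration

open Real
open scoped NNReal

/-- Sub-Gaussian moment bounds tensorize: a function of two independent variables is sub-Gaussian
around its mean if it is so in the first variable, around the conditional mean, and the conditional
mean is so in the second variable. -/
lemma hasSubgaussianMGF_prod {α β : Type*} [MeasurableSpace α] [MeasurableSpace β]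
    {μ : Measure α} {ν : Measure β} [IsProbabilityMeasure μ] [IsProbabilityMeasure ν]
    {F : α × β → ℝ} (hF : Measurable F) {M : ℝ} (hM : ∀ z, |F z| ≤ M) {a b : ℝ≥0}
    (h₁ : ∀ y, HasSubgaussianMGF (fun x => F (x, y) - ∫ x', F (x', y) ∂μ) a μ)
    (h₂ : HasSubgaussianMGF (fun y => ∫ x, F (x, y) ∂μ - ∫ y', ∫ x, F (x, y') ∂μ ∂ν) b ν) :
    HasSubgaussianMGF (fun z => F z - ∫ z', F z' ∂(μ.prod ν)) (a + b) (μ.prod ν) := by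
  have hFi : Integrable F (μ.prod ν) :=
    Integrable.of_bound hF.aestronglyMeasurable M (Filter.Eventually.of_forall hM)
  have hm : ∫ z', F z' ∂(μ.prod ν) = ∫ y', ∫ x, F (x, y') ∂μ ∂ν := integral_prod_symm _ hFi
  set m := ∫ z', F z' ∂(μ.prod ν)
  have hint (t : ℝ) : Integrable (fun z => exp (t * (F z - m))) (μ.prod ν) := by
    refine Integrable.of_bound (by fun_prop) (exp (|t| * (M + |m|)))
      (Filter.Eventually.of_forall fun z => ?_)
    rw [Real.norm_eq_abs, abs_exp]
    refine exp_le_exp.2 ((le_abs_self _).trans ?_)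
    rw [abs_mul]
    exact mul_le_mul_of_nonneg_left ((abs_sub _ _).trans (by linarith [hM z])) (abs_nonneg _)
  refine ⟨hint, fun t => ?_⟩
  have hcond (y : β) : ∫ x, exp (t * (F (x, y) - m)) ∂μ
      ≤ exp (a * t ^ 2 / 2) * exp (t * (∫ x, F (x, y) ∂μ - m)) := by
    have h := (h₁ y).mgf_le t
    have e (x : α) : exp (t * (F (x, y) - m)) = exp (t * (F (x, y) - ∫ x', F (x', y) ∂μ))
        * exp (t * (∫ x, F (x, y) ∂μ - m)) := by
      rw [← exp_add]; ring_nf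
    simp_rw [e]
    rw [integral_mul_const]
    exact mul_le_mul_of_nonneg_right h (exp_pos _).le
  rw [mgf, integral_prod_symm _ (hint t)]
  rw [← hm] at h₂
  calc ∫ y, ∫ x, exp (t * (F (x, y) - m)) ∂μ ∂ν
      ≤ ∫ y, exp (a * t ^ 2 / 2) * exp (t * (∫ x, F (x, y) ∂μ - m)) ∂ν :=
        integral_mono (hint t).integral_prod_right ((h₂.integrable_exp_mul t).const_mul _) hcond
    _ = exp (a * t ^ 2 / 2) * mgf (fun y => ∫ x, F (x, y) ∂μ - m) ν t := by
        rw [integral_const_mul, mgf]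
    _ ≤ exp (a * t ^ 2 / 2) * exp (b * t ^ 2 / 2) := by
        gcongr
        exact h₂.mgf_le t
    _ = exp ((a + b : ℝ≥0) * t ^ 2 / 2) := by
        rw [← exp_add, NNReal.coe_add]; ring_nf

/-- Hoeffding's lemma for a function whose range has diameter at most `c`. -/
lemma hasSubgaussianMGF_of_abs_sub_le {α : Type*} [MeasurableSpace α] {μ : Measure α}
    [IsProbabilityMeasure μ] {f : α → ℝ} (hf : Measurable f) {c : ℝ≥0}
    (hc : ∀ x x', |f x - f x'| ≤ c) :
    HasSubgaussianMGF (fun x => f x - ∫ x', f x' ∂μ) ((c / 2) ^ 2) μ := by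
  have : Nonempty α := nonempty_of_isProbabilityMeasure μ
  have hb : BddBelow (Set.range f) :=
    ⟨f (Classical.arbitrary α) - c, by
      rintro _ ⟨x, rfl⟩
      linarith [(abs_le.1 (hc (Classical.arbitrary α) x)).2]⟩
  have h := hasSubgaussianMGF_of_mem_Icc (a := ⨅ x, f x) (b := (⨅ x, f x) + c)
    hf.aemeasurable (μ := μ) (Filter.Eventually.of_forall fun x => ⟨ciInf_le hb x, by
      have : f x - c ≤ ⨅ x, f x := le_ciInf fun x' => by linarith [(abs_le.1 (hc x x')).2]
      linarith⟩)
  simpa using h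

/-- McDiarmid's inequality, in the form of a sub-Gaussian moment bound. -/
theorem hasSubgaussianMGF_of_bounded_differences {α : Type*} [MeasurableSpace α] {μ : Measure α}
    [IsProbabilityMeasure μ] {c : ℝ≥0} {M : ℝ} {n : ℕ} {F : (Fin n → α) → ℝ} (hF : Measurable F)
    (hM : ∀ x, |F x| ≤ M)
    (hc : ∀ i x x', (∀ j, j ≠ i → x j = x' j) → |F x - F x'| ≤ c) :
    HasSubgaussianMGF (fun x => F x - ∫ x', F x' ∂(Measure.pi fun _ => μ)) (n * (c / 2) ^ 2)
      (Measure.pi fun _ => μ) := by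
  induction n with
  | zero =>
    have : (fun x => F x - ∫ x', F x' ∂(Measure.pi fun _ : Fin 0 => μ)) = fun _ => 0 := by
      ext x
      rw [integral_congr_ae (g := fun _ => F x)
        (Filter.Eventually.of_forall fun x' => by rw [Subsingleton.elim x' x])]
      simp
    rw [this]
    simp
  | succ n ih =>
    set e := MeasurableEquiv.piFinSuccAbove (fun _ : Fin (n + 1) => α) 0
    have he : MeasurePreserving e (Measure.pi fun _ => μ) (μ.prod (Measure.pi fun _ => μ)) :=
      measurePreserving_piFinSuccAbove (fun _ : Fin (n + 1) => μ) 0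
    have he0 (a : α) (x : Fin n → α) : e.symm (a, x) 0 = a := rfl
    have hes (a : α) (x : Fin n → α) (j : Fin n) : e.symm (a, x) j.succ = x j := rfl
    set F' : α × (Fin n → α) → ℝ := fun z => F (e.symm z) with hF'
    have hF'm : Measurable F' := hF.comp e.symm.measurable
    have hF'i (y : Fin n → α) : Integrable (fun x => F' (x, y)) μ :=
      Integrable.of_bound (hF'm.comp measurable_prodMk_right).aestronglyMeasurable M
        (Filter.Eventually.of_forall fun x => hM _)
    have h₁ (y : Fin n → α) :
        HasSubgaussianMGF (fun x => F' (x, y) - ∫ x', F' (x', y) ∂μ) ((c / 2) ^ 2) μ := by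
      refine hasSubgaussianMGF_of_abs_sub_le (hF'm.comp measurable_prodMk_right) fun x x' => ?_
      refine hc 0 _ _ fun j hj => ?_
      obtain ⟨k, rfl⟩ := Fin.exists_succ_eq.2 hj
      rw [hes, hes]
    have h₂ := ih (F := fun y => ∫ x, F' (x, y) ∂μ)
      hF'm.stronglyMeasurable.integral_prod_left'.measurable
      (fun y => by
        rw [← Real.norm_eq_abs]
        exact (norm_integral_le_of_norm_le_const (C := M)
          (Filter.Eventually.of_forall fun x => hM _)).trans_eq (by simp))
      (fun i y y' hy => by
        rw [← integral_sub (hF'i y) (hF'i y'), ← Real.norm_eq_abs]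
        refine (norm_integral_le_of_norm_le_const (C := (c : ℝ))
          (Filter.Eventually.of_forall fun x => ?_)).trans_eq (by simp)
        refine hc i.succ _ _ fun j hj => ?_
        cases j using Fin.cases with
        | zero => rw [he0, he0]
        | succ k => rw [hes, hes, hy k fun h => hj (by rw [h])])
    have h := hasSubgaussianMGF_prod hF'm (fun z => hM _) h₁ h₂
    rw [← he.map_eq] at h
    have h' := HasSubgaussianMGF.of_map e.measurable.aemeasurable h
    rw [integral_map_equiv] at h'
    have hco : (n + 1 : ℕ) * (c / 2) ^ 2 = (c / 2) ^ 2 + n * (c / 2) ^ 2 := by push_cast; ring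
    rw [hco]
    simpa [hF', Function.comp_def] using h'

lemma integral_sq_le_of_hasSubgaussianMGF {Ω : Type*} [MeasurableSpace Ω] {μ : Measure Ω}
    {Z : Ω → ℝ} {c : ℝ≥0} (hc : 0 < c) (h : HasSubgaussianMGF Z c μ) :
    ∫ ω, Z ω ^ 2 ∂μ ≤ 8 * c := by
  set s := √(c : ℝ) with hs
  have hs0 : 0 < s := sqrt_pos.2 hc
  have hsq : s ^ 2 = c := sq_sqrt c.2
  have key (x : ℝ) : x ^ 2 ≤ 2 * (exp x + exp (-x)) := by
    rcases le_total 0 x with hx | hx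
    · nlinarith [quadratic_le_exp_of_nonneg hx, exp_pos (-x)]
    · nlinarith [quadratic_le_exp_of_nonneg (neg_nonneg.2 hx), exp_pos x]
  have i1 := h.integrable_exp_mul s⁻¹
  have i2 := h.integrable_exp_mul (-s⁻¹)
  have h1 : mgf Z μ s⁻¹ ≤ 2 ∧ mgf Z μ (-s⁻¹) ≤ 2 := by
    have e : exp (c * s⁻¹ ^ 2 / 2) ≤ 2 := by
      have h2 : (c : ℝ) * s⁻¹ ^ 2 = 1 := by
        rw [← hsq, ← mul_pow, mul_inv_cancel₀ hs0.ne', one_pow]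
      rw [h2]
      have h3 : exp (1 / 2) ^ 2 = exp 1 := by rw [← exp_nat_mul]; norm_num
      nlinarith [exp_one_lt_d9, exp_pos (1 / 2)]
    exact ⟨(h.mgf_le _).trans e, (h.mgf_le _).trans (by rwa [neg_sq])⟩
  calc ∫ ω, Z ω ^ 2 ∂μ ≤ ∫ ω, (2 * c) * (exp (s⁻¹ * Z ω) + exp (-s⁻¹ * Z ω)) ∂μ := by
        refine integral_mono (h.memLp 2).integrable_sq ((i1.add i2).const_mul _) fun ω => ?_
        have := mul_le_mul_of_nonneg_left (key (s⁻¹ * Z ω)) c.2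
        have e : (c : ℝ) * (s⁻¹ * Z ω) ^ 2 = Z ω ^ 2 := by
          rw [← hsq]; field_simp
        have e' : -s⁻¹ * Z ω = -(s⁻¹ * Z ω) := by ring
        change (c : ℝ) * _ ≤ (c : ℝ) * _ at this
        rw [e] at this
        simp only [e']
        linarith
    _ = (2 * c) * (mgf Z μ s⁻¹ + mgf Z μ (-s⁻¹)) := by
        rw [integral_const_mul, integral_add i1 i2, mgf, mgf]
    _ ≤ (2 * c) * (2 + 2) := by
        gcongr
        exacts [h1.1, h1.2]
    _ = 8 * c := by ring

lemma measureReal_abs_ge_le_of_hasSubgaussianMGF {Ω : Type*} [MeasurableSpace Ω] {μ : Measure Ω}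
    [IsProbabilityMeasure μ] {Z : Ω → ℝ} {c : ℝ≥0} (h : HasSubgaussianMGF Z c μ) {ε : ℝ}
    (hε : 0 ≤ ε) : μ.real {ω | ε ≤ |Z ω|} ≤ 2 * exp (-ε ^ 2 / (2 * c)) := by
  have hsub : {ω | ε ≤ |Z ω|} ⊆ {ω | ε ≤ Z ω} ∪ {ω | ε ≤ (-Z) ω} := fun ω hω => by
    rcases le_abs.1 (show ε ≤ |Z ω| from hω) with h' | h'
    exacts [Or.inl h', Or.inr h']
  calc μ.real {ω | ε ≤ |Z ω|} ≤ μ.real {ω | ε ≤ Z ω} + μ.real {ω | ε ≤ (-Z) ω} :=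
        (measureReal_mono hsub).trans (measureReal_union_le _ _)
    _ ≤ _ := by linarith [h.measure_ge_le hε, h.neg.measure_ge_le hε]

end Concentration

/-! ### Moments of the empirical dual value -/

section Sampling

open Real BoundedContinuousFunction
open scoped NNReal

lemma integral_comp_of_measurePreserving {α β : Type*} [MeasurableSpace α] [MeasurableSpace β]
    {μ : Measure α} {ν : Measure β} {f : α → β} (hf : MeasurePreserving f μ ν) {g : β → ℝ}
    (hg : Measurable g) : ∫ x, g (f x) ∂μ = ∫ y, g y ∂ν := by
  rw [← hf.map_eq, integral_map hf.measurable.aemeasurable hg.aestronglyMeasurable]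

/-- The mean square of an empirical average of a centred function bounded by `K` is at most
`K ^ 2 / n`. -/
lemma integral_sq_average_pi_le {β : Type*} [MeasurableSpace β] {ν : Measure β}
    [IsProbabilityMeasure ν] {n : ℕ} {r : β → ℝ} (hr : Measurable r) {K : ℝ}
    (hK : ∀ y, |r y| ≤ K) (h0 : ∫ y, r y ∂ν = 0) :
    ∫ y, ((n : ℝ)⁻¹ * ∑ j : Fin n, r (y j)) ^ 2 ∂(Measure.pi fun _ => ν) ≤ K ^ 2 / n := by
  have hLp : MemLp r 2 ν :=
    MemLp.of_bound hr.aestronglyMeasurable K (Filter.Eventually.of_forall hK)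
  have hvar := variance_sum_pi (ι := Fin n) (μ := fun _ => ν) (X := fun _ => r) fun _ => hLp
  have hmean : ∫ y, (∑ j : Fin n, fun y : Fin n → β => r (y j)) y ∂(Measure.pi fun _ => ν) = 0 := by
    simp only [Finset.sum_apply]
    rw [integral_finsetSum]
    · refine Finset.sum_eq_zero fun j _ => ?_
      rw [integral_comp_of_measurePreserving (measurePreserving_eval (fun _ : Fin n => ν) j) hr, h0]
    · exact fun j _ => Integrable.of_bound
        (hr.comp (measurable_pi_apply j)).aestronglyMeasurable K
        (Filter.Eventually.of_forall fun y => hK _)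
  have hmeas : Measurable (∑ j : Fin n, fun y : Fin n → β => r (y j)) := by
    fun_prop
  rw [variance_of_integral_eq_zero hmeas.aemeasurable hmean,
    variance_of_integral_eq_zero hr.aemeasurable h0] at hvar
  have hsq : ∫ y, r y ^ 2 ∂ν ≤ K ^ 2 := by
    have : ∫ y, r y ^ 2 ∂ν ≤ ∫ _, K ^ 2 ∂ν := by
      refine integral_mono hLp.integrable_sq (integrable_const _) fun y => ?_
      exact sq_le_sq' (abs_le.1 (hK y)).1 (abs_le.1 (hK y)).2
    simpa using this
  have e (y : Fin n → β) : ((n : ℝ)⁻¹ * ∑ j, r (y j)) ^ 2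
      = (n : ℝ)⁻¹ ^ 2 * (∑ j : Fin n, fun y : Fin n → β => r (y j)) y ^ 2 := by
    rw [mul_pow, Finset.sum_apply]
  simp_rw [e]
  rw [integral_const_mul, hvar]
  simp only [Finset.sum_const, Finset.card_univ, Fintype.card_fin, nsmul_eq_mul]
  rcases eq_or_ne n 0 with rfl | hn
  · simp
  · have hn' : (0 : ℝ) < n := by positivity
    calc (n : ℝ)⁻¹ ^ 2 * (n * ∫ y, r y ^ 2 ∂ν) = (∫ y, r y ^ 2 ∂ν) / n := by field_simp
      _ ≤ K ^ 2 / n := by gcongr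

variable {E : Type*} [NormedAddCommGroup E] [MeasurableSpace E] [BorelSpace E]
  [SecondCountableTopology E] {η : ℝ} {μ ν : Measure E}
  [IsProbabilityMeasure μ] [IsProbabilityMeasure ν] {n : ℕ}

/-- The expected squared violation of the first marginal constraint of the empirical problem, at the
population potentials and a sample point. -/
lemma IsSchrodinger.integral_marginal_error_le (hη : 0 ≤ η) {φ ψ : E →ᵇ ℝ}
    (h : IsSchrodinger η μ ν φ ψ) (hn : n ≠ 0) (i : Fin n) :
    ∫ p : (Fin n → E) × (Fin n → E),
        (1 - (n : ℝ)⁻¹ * ∑ j, gibbsDensity η φ ψ (p.1 i) (p.2 j)) ^ 2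
          ∂((Measure.pi fun _ => μ).prod (Measure.pi fun _ => ν)) ≤ exp (4 * η) / n := by
  have hn' : (n : ℝ) ≠ 0 := by positivity
  set r : E → E → ℝ := fun x y => 1 - gibbsDensity η φ ψ x y with hr
  have hrb (x y : E) : |r x y| ≤ exp (2 * η) := by
    rw [abs_le]
    have := add_one_le_exp (2 * η)
    constructor <;>
      linarith [h.gibbsDensity_le hη x y, gibbsDensity_pos η φ ψ x y, exp_pos (2 * η)]
  have he (x : E) (y : Fin n → E) : 1 - (n : ℝ)⁻¹ * ∑ j, gibbsDensity η φ ψ x (y j)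
      = (n : ℝ)⁻¹ * ∑ j, r x (y j) := by
    simp only [hr, Finset.sum_sub_distrib, Finset.sum_const, Finset.card_univ, Fintype.card_fin,
      nsmul_eq_mul, mul_one]
    rw [mul_sub, inv_mul_cancel₀ hn']
  simp_rw [he]
  have hcont : Continuous fun z : E × (Fin n → E) => ((n : ℝ)⁻¹ * ∑ j, r z.1 (z.2 j)) ^ 2 := by
    fun_prop
  have hmp : MeasurePreserving (Prod.map (Function.eval i) id :
      (Fin n → E) × (Fin n → E) → E × (Fin n → E))
      ((Measure.pi fun _ => μ).prod (Measure.pi fun _ => ν)) (μ.prod (Measure.pi fun _ => ν)) :=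
    (measurePreserving_eval (fun _ : Fin n => μ) i).prod (MeasurePreserving.id _)
  have hint : Integrable (fun z : E × (Fin n → E) => ((n : ℝ)⁻¹ * ∑ j, r z.1 (z.2 j)) ^ 2)
      (μ.prod (Measure.pi fun _ => ν)) := by
    refine integrable_of_continuous_of_abs_le hcont (exp (2 * η) ^ 2) fun z => ?_
    rw [abs_pow]
    refine pow_le_pow_left₀ (abs_nonneg _) ?_ 2
    rw [abs_mul, abs_inv, Nat.abs_cast]
    calc (n : ℝ)⁻¹ * |∑ j, r z.1 (z.2 j)| ≤ (n : ℝ)⁻¹ * ∑ _j : Fin n, exp (2 * η) := by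
          gcongr
          exact (Finset.abs_sum_le_sum_abs _ _).trans (Finset.sum_le_sum fun j _ => hrb _ _)
      _ = exp (2 * η) := by simp [hn']
  have hfst := integral_comp_of_measurePreserving hmp hcont.measurable
  simp only [Prod.map_fst, Prod.map_snd, Function.eval, id] at hfst
  rw [hfst, integral_prod _ hint]
  have hinner (x : E) : ∫ y, ((n : ℝ)⁻¹ * ∑ j : Fin n, r x (y j)) ^ 2 ∂(Measure.pi fun _ => ν)
      ≤ exp (4 * η) / n := by
    have h0 : ∫ y, r x y ∂ν = 0 := by
      have hi : Integrable (fun y => gibbsDensity η φ ψ x y) ν :=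
        integrable_gibbsDensity hη φ ψ continuous_const continuous_id
      rw [integral_sub (integrable_const _) hi, h.integral_right]
      simp
    have h4 : exp (4 * η) = exp (2 * η) ^ 2 := by rw [← exp_nat_mul]; ring_nf
    rw [h4]
    exact integral_sq_average_pi_le (by fun_prop : Continuous (r x)).measurable (hrb x) h0
  calc _ ≤ ∫ _, exp (4 * η) / n ∂μ :=
        integral_mono hint.integral_prod_left (integrable_const _) hinner
    _ = _ := by simp

lemma integrable_dualValue_empiricalMeasure (hη : 0 ≤ η) (hn : n ≠ 0)
    {R : Measure ((Fin n → E) × (Fin n → E))} [IsFiniteMeasure R] :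
    Integrable (fun p => dualValue η (empiricalMeasure p.1) (empiricalMeasure p.2)) R := by
  refine Integrable.of_bound (measurable_dualValue_empiricalMeasure hη hn).aestronglyMeasurable
    (3 * η) (Filter.Eventually.of_forall fun p => ?_)
  have := isProbabilityMeasure_empiricalMeasure hn p.1
  have := isProbabilityMeasure_empiricalMeasure hn p.2
  exact abs_dualValue_le hη

/-- The empirical dual objective at the population potentials is an unbiased estimator of the
population dual value. -/
lemma IsSchrodinger.integral_dualObjective_empiricalMeasure (hη : 0 ≤ η) {φ ψ : E →ᵇ ℝ}
    (h : IsSchrodinger η μ ν φ ψ) (hn : n ≠ 0) :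
    Integrable (fun p : (Fin n → E) × (Fin n → E) =>
        dualObjective η (empiricalMeasure p.1) (empiricalMeasure p.2) φ ψ)
      ((Measure.pi fun _ => μ).prod (Measure.pi fun _ => ν)) ∧
    ∫ p : (Fin n → E) × (Fin n → E),
        dualObjective η (empiricalMeasure p.1) (empiricalMeasure p.2) φ ψ
          ∂((Measure.pi fun _ => μ).prod (Measure.pi fun _ => ν)) = dualValue η μ ν := by
  have hn' : (n : ℝ) ≠ 0 := by positivity
  set W := (Measure.pi fun _ : Fin n => μ).prod (Measure.pi fun _ : Fin n => ν) with hW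
  have m1 (i : Fin n) : MeasurePreserving (fun p : (Fin n → E) × (Fin n → E) => p.1 i) W μ :=
    (measurePreserving_eval (fun _ : Fin n => μ) i).comp measurePreserving_fst
  have m2 (j : Fin n) : MeasurePreserving (fun p : (Fin n → E) × (Fin n → E) => p.2 j) W ν :=
    (measurePreserving_eval (fun _ : Fin n => ν) j).comp measurePreserving_snd
  have m3 (i j : Fin n) : MeasurePreserving
      (fun p : (Fin n → E) × (Fin n → E) => (p.1 i, p.2 j)) W (μ.prod ν) :=
    (measurePreserving_eval (fun _ : Fin n => μ) i).prod
      (measurePreserving_eval (fun _ : Fin n => ν) j)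
  have i1 (i : Fin n) : Integrable (fun p : (Fin n → E) × (Fin n → E) => φ (p.1 i)) W :=
    integrable_of_continuous_of_abs_le (by fun_prop) ‖φ‖ fun p => φ.norm_coe_le_norm _
  have i2 (j : Fin n) : Integrable (fun p : (Fin n → E) × (Fin n → E) => ψ (p.2 j)) W :=
    integrable_of_continuous_of_abs_le (by fun_prop) ‖ψ‖ fun p => ψ.norm_coe_le_norm _
  have i3 (i j : Fin n) : Integrable
      (fun p : (Fin n → E) × (Fin n → E) => gibbsDensity η φ ψ (p.1 i) (p.2 j)) W :=
    integrable_gibbsDensity hη φ ψ (by fun_prop) (by fun_prop)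
  have e1 (i : Fin n) : ∫ p, φ (p.1 i) ∂W = ∫ x, φ x ∂μ :=
    integral_comp_of_measurePreserving (m1 i) φ.continuous.measurable
  have e2 (j : Fin n) : ∫ p, ψ (p.2 j) ∂W = ∫ y, ψ y ∂ν :=
    integral_comp_of_measurePreserving (m2 j) ψ.continuous.measurable
  have e3 (i j : Fin n) : ∫ p, gibbsDensity η φ ψ (p.1 i) (p.2 j) ∂W = 1 := by
    rw [integral_comp_of_measurePreserving (m3 i j) (measurable_gibbsDensity φ ψ),
      integral_prod_gibbsDensity hη]
    simp [h.integral_right]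
  have s1 : Integrable (fun p : (Fin n → E) × (Fin n → E) => (n : ℝ)⁻¹ * ∑ i, φ (p.1 i)) W :=
    (integrable_finsetSum _ fun i _ => i1 i).const_mul _
  have s2 : Integrable (fun p : (Fin n → E) × (Fin n → E) => (n : ℝ)⁻¹ * ∑ j, ψ (p.2 j)) W :=
    (integrable_finsetSum _ fun j _ => i2 j).const_mul _
  have s3 (i : Fin n) : Integrable (fun p : (Fin n → E) × (Fin n → E) =>
      (n : ℝ)⁻¹ * ∑ j, gibbsDensity η φ ψ (p.1 i) (p.2 j)) W :=
    (integrable_finsetSum _ fun j _ => i3 i j).const_mul _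
  have s4 : Integrable (fun p : (Fin n → E) × (Fin n → E) =>
      (n : ℝ)⁻¹ * ∑ i, ((n : ℝ)⁻¹ * ∑ j, gibbsDensity η φ ψ (p.1 i) (p.2 j)) - 1) W :=
    ((integrable_finsetSum _ fun i _ => s3 i).const_mul _).sub (integrable_const _)
  have s12 : Integrable (fun p : (Fin n → E) × (Fin n → E) =>
      (n : ℝ)⁻¹ * ∑ i, φ (p.1 i) + (n : ℝ)⁻¹ * ∑ j, ψ (p.2 j)) W := s1.add s2
  simp only [dualObjective_empiricalMeasure hη hn]
  refine ⟨s12.sub s4, ?_⟩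
  rw [integral_sub s12 s4, integral_add s1 s2, integral_sub
    ((integrable_finsetSum _ fun i _ => s3 i).const_mul _) (integrable_const _),
    integral_const_mul, integral_const_mul, integral_const_mul,
    integral_finsetSum _ fun i _ => i1 i, integral_finsetSum _ fun j _ => i2 j,
    integral_finsetSum _ fun i _ => s3 i, h.dualValue_eq_integral hη]
  have e4 (i : Fin n) :
      ∫ p, (n : ℝ)⁻¹ * ∑ j, gibbsDensity η φ ψ (p.1 i) (p.2 j) ∂W = 1 := by
    rw [integral_const_mul, integral_finsetSum _ fun j _ => i3 i j]
    simp [e3, hn']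
  simp [e1, e2, e4, hn']

/-- The empirical dual value overestimates the population dual value on average, because the
population potentials are admissible in the empirical problem. -/
lemma dualValue_le_integral_dualValue_empiricalMeasure (hη : 0 ≤ η) (hn : n ≠ 0) :
    dualValue η μ ν ≤ ∫ p : (Fin n → E) × (Fin n → E),
      dualValue η (empiricalMeasure p.1) (empiricalMeasure p.2)
        ∂((Measure.pi fun _ => μ).prod (Measure.pi fun _ => ν)) := by
  obtain ⟨φ, ψ, h⟩ := exists_isSchrodinger μ ν hη
  obtain ⟨hi, he⟩ := h.integral_dualObjective_empiricalMeasure hη hn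
  rw [← he]
  refine integral_mono hi (integrable_dualValue_empiricalMeasure hη hn) fun p => ?_
  have := isProbabilityMeasure_empiricalMeasure hn p.1
  have := isProbabilityMeasure_empiricalMeasure hn p.2
  exact dualObjective_le_dualValue hη φ ψ

/-- The overestimation is of order `1 / n`, because the population potentials are nearly optimal in
the empirical problem, with an error quadratic in the violation of the marginal constraints. -/
lemma integral_dualValue_empiricalMeasure_le (hη : 0 ≤ η) (hn : n ≠ 0) :
    ∫ p : (Fin n → E) × (Fin n → E),
      dualValue η (empiricalMeasure p.1) (empiricalMeasure p.2)
        ∂((Measure.pi fun _ => μ).prod (Measure.pi fun _ => ν))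
      ≤ dualValue η μ ν + 2 * exp (10 * η) / n := by
  have hn' : (n : ℝ) ≠ 0 := by positivity
  obtain ⟨φ, ψ, h⟩ := exists_isSchrodinger μ ν hη
  obtain ⟨hi, he⟩ := h.integral_dualObjective_empiricalMeasure hη hn
  set W := (Measure.pi fun _ : Fin n => μ).prod (Measure.pi fun _ : Fin n => ν) with hW
  set A : Fin n → (Fin n → E) × (Fin n → E) → ℝ := fun i p =>
    (1 - (n : ℝ)⁻¹ * ∑ j, gibbsDensity η φ ψ (p.1 i) (p.2 j)) ^ 2 with hA
  set B : Fin n → (Fin n → E) × (Fin n → E) → ℝ := fun j p =>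
    (1 - (n : ℝ)⁻¹ * ∑ i, gibbsDensity η φ ψ (p.1 i) (p.2 j)) ^ 2 with hB
  have hbound (f : Fin n → ℝ) (hf : ∀ i, 0 ≤ f i ∧ f i ≤ exp (2 * η)) :
      |(1 - (n : ℝ)⁻¹ * ∑ i, f i) ^ 2| ≤ exp (2 * η) ^ 2 := by
    have h0 : 0 ≤ (n : ℝ)⁻¹ * ∑ i, f i :=
      mul_nonneg (by positivity) (Finset.sum_nonneg fun i _ => (hf i).1)
    have h1 : (n : ℝ)⁻¹ * ∑ i, f i ≤ exp (2 * η) := by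
      calc (n : ℝ)⁻¹ * ∑ i, f i ≤ (n : ℝ)⁻¹ * ∑ _i : Fin n, exp (2 * η) := by
            gcongr with i
            exact (hf i).2
        _ = exp (2 * η) := by simp [hn']
    rw [abs_pow]
    refine pow_le_pow_left₀ (abs_nonneg _) (abs_le.2 ?_) 2
    have := add_one_le_exp (2 * η)
    constructor <;> linarith
  have hg (x y : E) : 0 ≤ gibbsDensity η φ ψ x y ∧ gibbsDensity η φ ψ x y ≤ exp (2 * η) :=
    ⟨(gibbsDensity_pos _ _ _ _ _).le, h.gibbsDensity_le hη x y⟩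
  have hAi (i : Fin n) : Integrable (A i) W :=
    integrable_of_continuous_of_abs_le (by fun_prop) _ fun p => hbound _ fun j => hg _ _
  have hBi (j : Fin n) : Integrable (B j) W :=
    integrable_of_continuous_of_abs_le (by fun_prop) _ fun p => hbound _ fun i => hg _ _
  have hAe (i : Fin n) : ∫ p, A i p ∂W ≤ exp (4 * η) / n := h.integral_marginal_error_le hη hn i
  have hBe (j : Fin n) : ∫ p, B j p ∂W ≤ exp (4 * η) / n := by
    have := h.symm.integral_marginal_error_le hη hn j
    simp only [gibbsDensity_swap η ψ φ] at this
    rwa [← integral_prod_swap] at this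
  have sA : Integrable (fun p => (n : ℝ)⁻¹ * ∑ i, A i p) W :=
    (integrable_finsetSum _ fun i _ => hAi i).const_mul _
  have sB : Integrable (fun p => (n : ℝ)⁻¹ * ∑ j, B j p) W :=
    (integrable_finsetSum _ fun j _ => hBi j).const_mul _
  have hmean (C : Fin n → (Fin n → E) × (Fin n → E) → ℝ) (hC : ∀ i, Integrable (C i) W)
      (hCe : ∀ i, ∫ p, C i p ∂W ≤ exp (4 * η) / n) :
      ∫ p, (n : ℝ)⁻¹ * ∑ i, C i p ∂W ≤ exp (4 * η) / n := by
    rw [integral_const_mul, integral_finsetSum _ fun i _ => hC i]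
    calc (n : ℝ)⁻¹ * ∑ i, ∫ p, C i p ∂W ≤ (n : ℝ)⁻¹ * ∑ _i : Fin n, exp (4 * η) / n := by
          gcongr with i
          exact hCe i
      _ = exp (4 * η) / n := by
          rw [Finset.sum_const, Finset.card_univ, Fintype.card_fin, nsmul_eq_mul, ← mul_assoc,
            inv_mul_cancel₀ hn', one_mul]
  have sAB : Integrable (fun p => exp (6 * η) *
      ((n : ℝ)⁻¹ * ∑ i, A i p + (n : ℝ)⁻¹ * ∑ j, B j p)) W := (sA.add sB).const_mul _
  calc ∫ p, dualValue η (empiricalMeasure p.1) (empiricalMeasure p.2) ∂W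
      ≤ ∫ p, (dualObjective η (empiricalMeasure p.1) (empiricalMeasure p.2) φ ψ
          + exp (6 * η) * ((n : ℝ)⁻¹ * ∑ i, A i p + (n : ℝ)⁻¹ * ∑ j, B j p)) ∂W := by
        refine integral_mono (integrable_dualValue_empiricalMeasure hη hn) (hi.add sAB) fun p => ?_
        have := isProbabilityMeasure_empiricalMeasure hn p.1
        have := isProbabilityMeasure_empiricalMeasure hn p.2
        have hle := dualValue_le_add_marginal_error (P := empiricalMeasure p.1)
          (Q := empiricalMeasure p.2) hη (h.le_gibbsDensity hη) (h.gibbsDensity_le hη)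
        simpa only [integral_empiricalMeasure] using hle
    _ = dualValue η μ ν + exp (6 * η) * (∫ p, (n : ℝ)⁻¹ * ∑ i, A i p ∂W
          + ∫ p, (n : ℝ)⁻¹ * ∑ j, B j p ∂W) := by
        rw [integral_add hi sAB, he, integral_const_mul, integral_add sA sB]
    _ ≤ dualValue η μ ν + exp (6 * η) * (exp (4 * η) / n + exp (4 * η) / n) := by
        gcongr
        exacts [hmean A hAi hAe, hmean B hBi hBe]
    _ = dualValue η μ ν + 2 * exp (10 * η) / n := by
        have : exp (10 * η) = exp (6 * η) * exp (4 * η) := by rw [← exp_add]; ring_nf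
        rw [this]
        ring

/-- The empirical dual value is sub-Gaussian around its mean, with variance proxy `η² / (2n)`. -/
lemma hasSubgaussianMGF_dualValue_empiricalMeasure {η : ℝ≥0} (hn : n ≠ 0) :
    HasSubgaussianMGF (fun p : (Fin n → E) × (Fin n → E) =>
      dualValue η (empiricalMeasure p.1) (empiricalMeasure p.2)
        - ∫ q : (Fin n → E) × (Fin n → E),
            dualValue η (empiricalMeasure q.1) (empiricalMeasure q.2)
              ∂((Measure.pi fun _ => μ).prod (Measure.pi fun _ => ν)))
      (η ^ 2 / (2 * n)) ((Measure.pi fun _ => μ).prod (Measure.pi fun _ => ν)) := by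
  have hη : (0 : ℝ) ≤ η := η.2
  set F : (Fin n → E) × (Fin n → E) → ℝ := fun p =>
    dualValue η (empiricalMeasure p.1) (empiricalMeasure p.2) with hF
  have hFm : Measurable F := measurable_dualValue_empiricalMeasure hη hn
  have hFb (p : (Fin n → E) × (Fin n → E)) : |F p| ≤ 3 * η := by
    have := isProbabilityMeasure_empiricalMeasure hn p.1
    have := isProbabilityMeasure_empiricalMeasure hn p.2
    exact abs_dualValue_le hη
  have hFi (y : Fin n → E) : Integrable (fun x => F (x, y)) (Measure.pi fun _ => μ) :=
    Integrable.of_bound (hFm.comp measurable_prodMk_right).aestronglyMeasurable (3 * η)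
      (Filter.Eventually.of_forall fun x => hFb _)
  have hdiff₂ (i : Fin n) (x y y' : Fin n → E) (hy : ∀ j, j ≠ i → y j = y' j) :
      |F (x, y) - F (x, y')| ≤ (η / n : ℝ≥0) := by
    have := isProbabilityMeasure_empiricalMeasure hn x
    have := isProbabilityMeasure_empiricalMeasure hn y
    have := isProbabilityMeasure_empiricalMeasure hn y'
    simp only [hF]
    rw [dualValue_comm hη (P := empiricalMeasure x) (Q := empiricalMeasure y),
      dualValue_comm hη (P := empiricalMeasure x) (Q := empiricalMeasure y')]
    simpa using abs_dualValue_empiricalMeasure_sub_le hη hn y y' x i hy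
  have h₁ (y : Fin n → E) := hasSubgaussianMGF_of_bounded_differences (μ := μ) (c := η / n)
    (hFm.comp (measurable_prodMk_right (y := y))) (fun x => hFb _) (fun i x x' hx => by
      simpa [hF] using abs_dualValue_empiricalMeasure_sub_le hη hn x x' y i hx)
  have h₂ := hasSubgaussianMGF_of_bounded_differences (μ := ν) (c := η / n) (M := 3 * η)
    (F := fun y => ∫ x, F (x, y) ∂(Measure.pi fun _ => μ))
    hFm.stronglyMeasurable.integral_prod_left'.measurable
    (fun y => by
      rw [← Real.norm_eq_abs]
      exact (norm_integral_le_of_norm_le_const (C := 3 * (η : ℝ))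
        (Filter.Eventually.of_forall fun x => hFb _)).trans_eq (by simp))
    (fun i y y' hy => by
      rw [← integral_sub (hFi y) (hFi y'), ← Real.norm_eq_abs]
      exact (norm_integral_le_of_norm_le_const (C := ((η / n : ℝ≥0) : ℝ))
        (Filter.Eventually.of_forall fun x => hdiff₂ i x y y' hy)).trans_eq (by simp))
  have h := hasSubgaussianMGF_prod hFm hFb h₁ h₂
  have hn' : (n : ℝ≥0) ≠ 0 := by positivity
  have hc : (n : ℝ≥0) * (η / n / 2) ^ 2 + n * (η / n / 2) ^ 2 = η ^ 2 / (2 * n) := by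
    field_simp
    norm_num
  rwa [hc] at h

end Sampling

/-! ### The plug-in estimator -/

lemma ae_empiricalMeasure_of_forall {E : Type*} [MeasurableSpace E]
    [MeasurableSingletonClass E] {n : ℕ} (x : Fin n → E) {p : E → Prop} (h : ∀ i, p (x i)) :
    ∀ᵐ z ∂(empiricalMeasure x), p z := by
  refine Measure.ae_smul_measure ?_ _
  rw [← Measure.sum_fintype, Measure.ae_sum_iff]
  exact fun i => by simpa [ae_dirac_eq] using h i

lemma plugInCost_eq_dualValue_div {E : Type*} [NormedAddCommGroup E] [MeasurableSpace E]
    [BorelSpace E] [SecondCountableTopology E] {η : ℝ} (hη : 0 < η) {n : ℕ} (hn : n ≠ 0)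
    {x y : Fin n → E} (hx : ∀ i, ‖x i‖ ≤ 1 / 2) (hy : ∀ j, ‖y j‖ ≤ 1 / 2) :
    plugInCost η x y = dualValue η (empiricalMeasure x) (empiricalMeasure y) / η := by
  have := isProbabilityMeasure_empiricalMeasure hn x
  have := isProbabilityMeasure_empiricalMeasure hn y
  exact entropicCost_eq_dualValue_div hη (ae_empiricalMeasure_of_forall x hx)
    (ae_empiricalMeasure_of_forall y hy)

theorem mainTheorem1 (η : ℝ) (hη : 0 < η) :
    ∃ C : ℝ, 0 < C ∧
      ∀ (d : ℕ) (μ ν : Measure (EuclideanSpace ℝ (Fin d)))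
        [IsProbabilityMeasure μ] [IsProbabilityMeasure ν],
        (∀ᵐ x ∂μ, ‖x‖ ≤ 1 / 2) → (∀ᵐ y ∂ν, ‖y‖ ≤ 1 / 2) →
      ∀ (n : ℕ), 1 ≤ n →
      ∀ (Ω : Type*) [MeasurableSpace Ω] (Pr : Measure Ω) [IsProbabilityMeasure Pr]
        (X Y : Fin n → Ω → EuclideanSpace ℝ (Fin d)),
        (∀ i, HasLaw (X i) μ Pr) → (∀ j, HasLaw (Y j) ν Pr) →
        iIndepFun X Pr → iIndepFun Y Pr →
        IndepFun (fun ω i => X i ω) (fun ω j => Y j ω) Pr →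
        -- the plug-in cost is integrable and square-integrable around the population cost
        Integrable (fun ω => plugInCost η (fun i => X i ω) (fun j => Y j ω)) Pr ∧
        Integrable (fun ω => |plugInCost η (fun i => X i ω) (fun j => Y j ω)
          - entropicCost η μ ν| ^ 2) Pr ∧
        -- mean squared error
        ∫ ω, |plugInCost η (fun i => X i ω) (fun j => Y j ω) - entropicCost η μ ν| ^ 2 ∂Pr
          ≤ C / n ∧
        -- bias
        |(∫ ω, plugInCost η (fun i => X i ω) (fun j => Y j ω) ∂Pr) - entropicCost η μ ν|
          ≤ C / n ∧
        -- high-probability bound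
        ∀ t : ℝ, 0 < t →
          1 - 6 * Real.exp (-t) ≤
            Pr.real {ω | |plugInCost η (fun i => X i ω) (fun j => Y j ω) - entropicCost η μ ν|
              ≤ C * (t / n + Real.sqrt (t / n))} := by
  -- `B / n` bounds the bias; `8` comes from the variance of a sub-Gaussian variable.
  set B : ℝ := 2 * Real.exp (10 * η) / η with hB
  have hB0 : 0 < B := by positivity
  refine ⟨8 + B + 2 * B ^ 2, by positivity, ?_⟩
  intro d μ ν _ _ hμ hν n hn1 Ω _ Pr _ X Y hX hY hXi hYi hXY
  have hn : n ≠ 0 := by omega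
  have hnpos : (0 : ℝ) < n := by positivity
  have hn1' : (1 : ℝ) ≤ n := by exact_mod_cast hn1
  set W := (Measure.pi fun _ : Fin n => μ).prod (Measure.pi fun _ : Fin n => ν) with hW
  have hlaw : HasLaw (fun ω => ((fun i => X i ω), (fun j => Y j ω))) W Pr :=
    (indepFun_iff_hasLaw_prodMk_prod (hXi.hasLaw_pi hX) (hYi.hasLaw_pi hY)).1 hXY
  set V := dualValue η μ ν
  set F : (Fin n → EuclideanSpace ℝ (Fin d)) × (Fin n → EuclideanSpace ℝ (Fin d)) → ℝ :=
    fun p => dualValue η (empiricalMeasure p.1) (empiricalMeasure p.2) with hF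
  set m := ∫ p, F p ∂W with hm
  set Z : Ω → ℝ := fun ω => F ((fun i => X i ω), (fun j => Y j ω)) - m with hZ
  have hFW : Integrable F W := integrable_dualValue_empiricalMeasure hη.le hn
  obtain ⟨c, hc, hsub⟩ : ∃ c : NNReal, (c : ℝ) = η ^ 2 / (2 * n) ∧ HasSubgaussianMGF Z c Pr := by
    refine ⟨⟨η, hη.le⟩ ^ 2 / (2 * n), by push_cast; rfl, ?_⟩
    have h := hasSubgaussianMGF_dualValue_empiricalMeasure (μ := μ) (ν := ν) (η := ⟨η, hη.le⟩) hn
    rw [← hW, ← hlaw.map_eq] at h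
    have h' := HasSubgaussianMGF.of_map hlaw.aemeasurable h
    rw [hlaw.map_eq] at h'
    exact h'
  have hZi : Integrable Z Pr := hsub.integrable
  have hZ0 : ∫ ω, Z ω ∂Pr = 0 := by
    have h := hlaw.integral_comp (f := fun p => F p - m)
      (hFW.aestronglyMeasurable.sub aestronglyMeasurable_const)
    rw [integral_sub hFW (integrable_const _)] at h
    rw [integral_const, probReal_univ, one_smul, sub_self] at h
    exact h
  have hZ2i : Integrable (fun ω => Z ω ^ 2) Pr := (hsub.memLp 2).integrable_sq
  have hZ2 : ∫ ω, Z ω ^ 2 ∂Pr ≤ 4 * η ^ 2 / n := by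
    have hc0 : 0 < c := NNReal.coe_pos.1 (by rw [hc]; positivity)
    refine (integral_sq_le_of_hasSubgaussianMGF hc0 hsub).trans_eq ?_
    rw [hc]
    field_simp
    norm_num
  -- the bias of the estimator, in units of the cost
  set b := (m - V) / η with hb
  have hb0 : 0 ≤ b := by
    have := dualValue_le_integral_dualValue_empiricalMeasure (μ := μ) (ν := ν) hη.le hn
    exact div_nonneg (sub_nonneg.2 this) hη.le
  have hbB : b ≤ B / n := by
    have h := integral_dualValue_empiricalMeasure_le (μ := μ) (ν := ν) hη.le hn
    have h' : m - V ≤ 2 * Real.exp (10 * η) / n := by linarith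
    calc b ≤ 2 * Real.exp (10 * η) / n / η := by rw [hb]; gcongr
      _ = B / n := by rw [hB]; ring
  have hS : entropicCost η μ ν = V / η := entropicCost_eq_dualValue_div hη hμ hν
  have hae : ∀ᵐ ω ∂Pr, plugInCost η (fun i => X i ω) (fun j => Y j ω)
      - entropicCost η μ ν = Z ω / η + b := by
    have hXae : ∀ᵐ ω ∂Pr, ∀ i, ‖X i ω‖ ≤ 1 / 2 := ae_all_iff.2 fun i =>
      ae_of_ae_map (hX i).aemeasurable (by rw [(hX i).map_eq]; exact hμ)
    have hYae : ∀ᵐ ω ∂Pr, ∀ j, ‖Y j ω‖ ≤ 1 / 2 := ae_all_iff.2 fun j =>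
      ae_of_ae_map (hY j).aemeasurable (by rw [(hY j).map_eq]; exact hν)
    filter_upwards [hXae, hYae] with ω h1 h2
    rw [plugInCost_eq_dualValue_div hη hn h1 h2, hS]
    simp only [hZ, hF, hb]
    ring
  have hpi : Integrable (fun ω => plugInCost η (fun i => X i ω) (fun j => Y j ω)) Pr := by
    refine (((hZi.div_const η).add (integrable_const b)).add
      (integrable_const (entropicCost η μ ν))).congr ?_
    filter_upwards [hae] with ω h
    simp only [Pi.add_apply]
    linarith
  have hsqae : (fun ω => (Z ω / η + b) ^ 2) =ᵐ[Pr]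
      fun ω => |plugInCost η (fun i => X i ω) (fun j => Y j ω) - entropicCost η μ ν| ^ 2 := by
    filter_upwards [hae] with ω h
    rw [h, sq_abs]
  have hsqi : Integrable (fun ω => (Z ω / η + b) ^ 2) Pr := by
    have : ∀ ω, (Z ω / η + b) ^ 2 = (η⁻¹ ^ 2 * Z ω ^ 2 + 2 * b / η * Z ω) + b ^ 2 :=
      fun ω => by ring
    simp_rw [this]
    exact ((hZ2i.const_mul _).add (hZi.const_mul _)).add (integrable_const _)
  have hbn : b ^ 2 ≤ B ^ 2 / n := by
    calc b ^ 2 ≤ (B / n) ^ 2 := by gcongr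
      _ = B ^ 2 / n / n := by ring
      _ ≤ B ^ 2 / n := div_le_self (by positivity) hn1'
  refine ⟨hpi, hsqi.congr hsqae, ?_, ?_, ?_⟩
  · rw [← integral_congr_ae hsqae]
    calc ∫ ω, (Z ω / η + b) ^ 2 ∂Pr ≤ ∫ ω, (2 * η⁻¹ ^ 2 * Z ω ^ 2 + 2 * b ^ 2) ∂Pr := by
          refine integral_mono hsqi ((hZ2i.const_mul _).add (integrable_const _)) fun ω => ?_
          have h := add_sq_le (a := Z ω / η) (b := b)
          have e : (Z ω / η) ^ 2 = η⁻¹ ^ 2 * Z ω ^ 2 := by ring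
          rw [e] at h
          simp only
          linarith
      _ = 2 * η⁻¹ ^ 2 * ∫ ω, Z ω ^ 2 ∂Pr + 2 * b ^ 2 := by
          rw [integral_add (hZ2i.const_mul _) (integrable_const _), integral_const_mul]
          simp
      _ ≤ 2 * η⁻¹ ^ 2 * (4 * η ^ 2 / n) + 2 * (B ^ 2 / n) := by gcongr
      _ = (8 + 2 * B ^ 2) / n := by field_simp; ring
      _ ≤ (8 + B + 2 * B ^ 2) / n := by gcongr; linarith
  · have h1 : (∫ ω, plugInCost η (fun i => X i ω) (fun j => Y j ω) ∂Pr) - entropicCost η μ ν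
        = b := by
      have h2 : ∫ ω, (plugInCost η (fun i => X i ω) (fun j => Y j ω) - entropicCost η μ ν) ∂Pr
          = ∫ ω, (Z ω / η + b) ∂Pr := integral_congr_ae hae
      rw [integral_sub hpi (integrable_const _), integral_add (hZi.div_const _)
        (integrable_const _), integral_div, hZ0] at h2
      simpa using h2
    rw [h1, abs_of_nonneg hb0]
    refine hbB.trans ?_
    gcongr
    nlinarith
  · intro t ht
    rcases lt_or_ge t 1 with ht1 | ht1
    · -- here the claimed probability is negative, as `6 / e > 1`
      have h1 : (1 : ℝ) ≤ 6 * Real.exp (-t) := by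
        have h2 : Real.exp (-1) ≤ Real.exp (-t) := Real.exp_le_exp.2 (by linarith)
        have h3 : Real.exp 1 * Real.exp (-1) = 1 := by rw [← Real.exp_add]; simp
        nlinarith [Real.exp_one_lt_d9, Real.exp_pos (-1)]
      linarith [measureReal_nonneg (μ := Pr) (s := {ω | |plugInCost η (fun i => X i ω)
        (fun j => Y j ω) - entropicCost η μ ν|
          ≤ (8 + B + 2 * B ^ 2) * (t / n + Real.sqrt (t / n))})]
    · set S := {ω | |plugInCost η (fun i => X i ω) (fun j => Y j ω) - entropicCost η μ ν|
          ≤ (8 + B + 2 * B ^ 2) * (t / n + Real.sqrt (t / n))} with hSdef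
      set T := {ω | η * Real.sqrt (t / n) ≤ |Z ω|}
      have htail : Pr.real T ≤ 2 * Real.exp (-t) := by
        refine (measureReal_abs_ge_le_of_hasSubgaussianMGF hsub (by positivity)).trans_eq ?_
        congr 2
        rw [hc, mul_pow, Real.sq_sqrt (by positivity)]
        field_simp
      have hcover : ∀ᵐ ω ∂Pr, ω ∈ S ∪ T := by
        filter_upwards [hae] with ω hω
        rw [Set.mem_union, or_iff_not_imp_right]
        intro hωT
        have hZω : |Z ω| < η * Real.sqrt (t / n) := not_le.1 hωT
        rw [hSdef, Set.mem_ofPred_eq, hω]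
        have h1 : |Z ω / η| ≤ Real.sqrt (t / n) := by
          rw [abs_div, abs_of_pos hη, div_le_iff₀ hη, mul_comm]
          exact hZω.le
        have h2 : b ≤ B * (t / n) := by
          refine hbB.trans ?_
          rw [mul_div_assoc']
          gcongr
          nlinarith
        have h3 : 0 ≤ Real.sqrt (t / n) := Real.sqrt_nonneg _
        have h4 : 0 ≤ t / n := by positivity
        calc |Z ω / η + b| ≤ |Z ω / η| + |b| := abs_add_le _ _
          _ ≤ Real.sqrt (t / n) + B * (t / n) := by
              rw [abs_of_nonneg hb0]
              gcongr
          _ ≤ (8 + B + 2 * B ^ 2) * Real.sqrt (t / n) + (8 + B + 2 * B ^ 2) * (t / n) := by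
              refine add_le_add (le_mul_of_one_le_left h3 (by nlinarith)) ?_
              gcongr
              nlinarith
          _ = _ := by ring
      have hfull : Pr.real (S ∪ T) = 1 := by
        have hST : (S ∪ T : Set Ω) =ᵐ[Pr] Set.univ := Filter.eventuallyEq_univ.2 hcover
        rw [measureReal_congr hST, probReal_univ]
      have := measureReal_union_le (μ := Pr) S T
      linarith [Real.exp_pos (-t)]
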